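/- **Two-sided Liouville theorem (elliptic case).** Let $n\ge 2$ and consider in $\mathbb R^n$ the equation $$\mathcal L u\equiv -D_i\big(a_{ij}(x)D_ju\big)+b_i(x)D_iu=0$$ (repeated indices are summed from $1$ to $n$). Here the $a_{ij}$ are measurable and essentially bounded, and for some constant $\nu>0$, $$\nu|\xi|^2\le a_{ij}(x)\xi_i\xi_j\le\nu^{-1}|\xi|^2\qquad\text{for a.e. }x\in\mathbb R^n\text{ and all }\xi\in\mathbb R^n$$ (if $(a_{ij})$ is symmetric, essential boundedness follows from these inequalities). Let $\mathbf b=(b_i)\in L_{q,\mathrm{loc}}(\mathbb R^n)$ for some $q$ with $\frac n2<q\le n$, and let $\operatorname{div}\mathbf b\le 0$ in the sense of distributions, i.e. $\int_{\mathbb R^n} b_iD_i\varphi\,dx\ge 0$ for all nonnegative $\varphi\in C_0^\infty(\mathbb R^n)$. Assume that $$\liminf_{R\to\infty}\ R^{1-\frac nq}\,\|\mathbf b\|_{L_q(B_R)}<\infty,\qquad B_R=\{x\in\mathbb R^n:|x|<R\}.$$ Let $u:\mathbb R^n\to\mathbb R$ be a bounded, locally Lipschitz (in particular, a bounded Lipschitz)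 solution of $\mathcal Lu=0$ in $\mathbb R^n$, i.e. $$\int_{\mathbb R^n}\big(a_{ij}D_ju\,D_i\eta+b_iD_iu\,\eta\big)\,dx=0$$ for every nonnegative Lipschitz function $\eta$ with compact support. Then $u$ is constant. -/

import Mathlib

open MeasureTheory Filter Topology
open scoped ContDiff

noncomputable section

namespace EllipticLiouville

/-- The space `ℝⁿ` with its Euclidean norm. -/
abbrev Rn (n : ℕ) : Type := EuclideanSpace ℝ (Fin n)

/-- The partial derivative `D_i f (x)`. It exists at almost every point when `f` is locally
Lipschitz (Rademacher), and it is only used under integrals. -/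
def pd {n : ℕ} (i : Fin n) (f : Rn n → ℝ) (x : Rn n) : ℝ :=
  fderiv ℝ f x (EuclideanSpace.single i 1)

/-- The two-sided ellipticity condition `ν|ξ|² ≤ a_ij(x) ξ_i ξ_j ≤ ν⁻¹|ξ|²` for a.e. `x`
and all `ξ`. -/
def IsUniformlyElliptic {n : ℕ} (a : Rn n → Matrix (Fin n) (Fin n) ℝ) (ν : ℝ) : Prop :=
  ∀ᵐ x ∂(volume : Measure (Rn n)), ∀ ξ : Rn n,
    ν * ‖ξ‖ ^ 2 ≤ ∑ i, ∑ j, a x i j * ξ i * ξ j ∧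
      ∑ i, ∑ j, a x i j * ξ i * ξ j ≤ ν⁻¹ * ‖ξ‖ ^ 2

/-- `b ∈ L_{q,loc}(ℝⁿ)`. -/
def MemLqLoc {n : ℕ} (b : Rn n → Rn n) (q : ℝ) : Prop :=
  ∀ K : Set (Rn n), IsCompact K → MemLp b (ENNReal.ofReal q) (volume.restrict K)

/-- The distributional divergence of `b`, evaluated at a test function:
`⟨div b, φ⟩ = -∫ b_i D_i φ dx`. -/
def distDiv {n : ℕ} (b : Rn n → Rn n) (φ : Rn n → ℝ) : ℝ :=
  -∫ x, ∑ i, b x i * pd i φ x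

/-- `div b ≤ 0` in the sense of distributions (meaningful for locally integrable `b`). -/
def DivNonpos {n : ℕ} (b : Rn n → Rn n) : Prop :=
  ∀ φ : Rn n → ℝ, ContDiff ℝ ∞ φ → HasCompactSupport φ → (∀ x, 0 ≤ φ x) → distDiv b φ ≤ 0

/-- The scaled norm `𝒩(R) = R^{1-n/q} ‖b‖_{q,B_R}`, as an extended nonnegative number
(used for large `R`). -/
def scaledNorm {n : ℕ} (b : Rn n → Rn n) (q R : ℝ) : ENNReal :=
  ENNReal.ofReal (R ^ (1 - (n : ℝ) / q)) *
    eLpNorm b (ENNReal.ofReal q) (volume.restrict (Metric.ball (0 : Rn n) R))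

/-- The form `∫ (a_ij D_j u D_i η + b_i D_i u η) dx` of the operator
`ℒu = -D_i(a_ij D_j u) + b_i D_i u`. -/
def weakForm {n : ℕ} (a : Rn n → Matrix (Fin n) (Fin n) ℝ) (b : Rn n → Rn n)
    (u η : Rn n → ℝ) : ℝ :=
  ∫ x, ((∑ i, ∑ j, a x i j * pd j u x * pd i η x) + (∑ i, b x i * pd i u x) * η x)

/-- Nonnegative Lipschitz test functions of compact support. -/
def IsTest {n : ℕ} (η : Rn n → ℝ) : Prop :=
  (∃ K, LipschitzWith K η) ∧ HasCompactSupport η ∧ ∀ x, 0 ≤ η x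

/-- Locally Lipschitz subsolutions of `ℒu = 0` in `ℝⁿ`. -/
def IsSubsolution {n : ℕ} (a : Rn n → Matrix (Fin n) (Fin n) ℝ) (b : Rn n → Rn n)
    (u : Rn n → ℝ) : Prop :=
  LocallyLipschitz u ∧ ∀ η, IsTest η → weakForm a b u η ≤ 0

/-- Locally Lipschitz supersolutions of `ℒu = 0` in `ℝⁿ`. -/
def IsSupersolution {n : ℕ} (a : Rn n → Matrix (Fin n) (Fin n) ℝ) (b : Rn n → Rn n)
    (u : Rn n → ℝ) : Prop :=
  LocallyLipschitz u ∧ ∀ η, IsTest η → 0 ≤ weakForm a b u η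

/-- Locally Lipschitz solutions of `ℒu = 0` in `ℝⁿ`. -/
def IsSolution {n : ℕ} (a : Rn n → Matrix (Fin n) (Fin n) ℝ) (b : Rn n → Rn n)
    (u : Rn n → ℝ) : Prop :=
  IsSubsolution a b u ∧ IsSupersolution a b u

end EllipticLiouville

end

/-! The theorem is an oscillation argument resting on a growth lemma, `exists_lower_bound`: a
supersolution in the unit ball with values in [0, 1] that is at least 1/2 on half of B_{1/2} is at
least δ > 0 throughout B_{1/2}, with δ depending on the drift only through a bound for its L_q norm
on the ball. Rescaling x ↦ Rx replaces b by R b(Rx), whose L_q norm on the unit ball is exactly the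
scaled norm of b on B_R. The liminf hypothesis thus gives arbitrarily large R with one common δ. If
u is not constant, normalise it to v with infimum 0 and supremum 1. On B_{R/2} either v or 1 - v is
at least 1/2 on half of the ball, and both are supersolutions because u is a solution. Hence one of
them is at least δ on B_{R/2}, which is absurd once R is so large that B_{R/2} contains points where
v < δ and where v > 1 - δ.

The growth lemma is a bound from above for w = -log v, which satisfies an inequality with an extra
good term a∇w·∇w. The sign of div b is what makes the drift harmless: when the equation is tested,
b·∇w occurs as the b-derivative of a nonnegative compactly supported function, whose integral has a
sign, plus a term in which the derivative falls on the cutoff and ∇w is gone. What remains is |b|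
times w or (w - k)₊², and Hölder's inequality puts the second factor in L_{s/2} with s = 2q/(q-1).
Since q > n/2, this s lies strictly below the Sobolev exponent.

Two estimates follow. `BallCoeff.log_estimate` bounds the weighted energy of w, and
`weighted_poincare`, which exploits that w ≤ log 2 on a set of definite measure, turns it into an
L_s bound (`exists_log_bound`). `BallCoeff.caccioppoli` feeds a De Giorgi iteration
(`BallCoeff.truncEnergy_step`, `exists_sup_bound`) that turns the L_s bound into a pointwise bound
on B_{1/2}. -/

noncomputable section

namespace EllipticLiouville

/-! ### Gradients and the calculus of a.e. differentiable functions -/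

section Gradient

variable {n : ℕ}

theorem gradient_apply (f : Rn n → ℝ) (x : Rn n) (i : Fin n) :
    gradient f x i = pd i f x := by
  have h : (InnerProductSpace.toDual ℝ (Rn n)) (gradient f x) = fderiv ℝ f x := toDual_gradient
  rw [pd, ← h, InnerProductSpace.toDual_apply_apply]
  rw [EuclideanSpace.inner_single_right]
  simp

theorem norm_gradient (f : Rn n → ℝ) (x : Rn n) : ‖gradient f x‖ = ‖fderiv ℝ f x‖ := by
  have h : (InnerProductSpace.toDual ℝ (Rn n)) (gradient f x) = fderiv ℝ f x := toDual_gradient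
  rw [← h, LinearIsometryEquiv.norm_map]

theorem measurable_gradient (f : Rn n → ℝ) : Measurable (gradient f) :=
  (InnerProductSpace.toDual ℝ (Rn n)).symm.continuous.measurable.comp (measurable_fderiv ℝ f)

theorem norm_gradient_le {f : Rn n → ℝ} {K : NNReal} (hf : LipschitzWith K f) (x : Rn n) :
    ‖gradient f x‖ ≤ K := by
  rw [norm_gradient]
  exact norm_fderiv_le_of_lipschitz ℝ hf

theorem gradient_congr {f g : Rn n → ℝ} {x : Rn n} (h : f =ᶠ[𝓝 x] g) :
    gradient f x = gradient g x := by
  unfold gradient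
  rw [h.fderiv_eq]

/-- A zero of a nonnegative function is a minimum, and the derivative has value 0 where it does not
exist. Hence gradients of cutoffs and truncations vanish at every zero, including the boundary of
the support. -/
theorem gradient_eq_zero_of_nonneg {f : Rn n → ℝ} (hf : ∀ x, 0 ≤ f x) {x : Rn n}
    (hx : f x = 0) : gradient f x = 0 := by
  have : IsLocalMin f x := Eventually.of_forall fun y => by rw [hx]; exact hf y
  unfold gradient
  rw [this.fderiv_eq_zero, map_zero]

theorem hasGradientAt_mul {f g : Rn n → ℝ} {f' g' x : Rn n}
    (hf : HasGradientAt f f' x) (hg : HasGradientAt g g' x) :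
    HasGradientAt (fun y => f y * g y) (f x • g' + g x • f') x := by
  rw [hasGradientAt_iff_hasFDerivAt] at *
  rw [map_add, map_smul, map_smul]
  exact hf.mul hg

theorem hasGradientAt_comp {f : Rn n → ℝ} {φ : ℝ → ℝ} {f' x : Rn n} {φ' : ℝ}
    (hφ : HasDerivAt φ φ' (f x)) (hf : HasGradientAt f f' x) :
    HasGradientAt (fun y => φ (f y)) (φ' • f') x := by
  rw [hasGradientAt_iff_hasFDerivAt] at *
  rw [map_smul]
  exact hφ.comp_hasFDerivAt x hf

theorem ae_hasGradientAt {f : Rn n → ℝ} {K : NNReal} (hf : LipschitzWith K f) :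
    ∀ᵐ x ∂(volume : Measure (Rn n)), HasGradientAt f (gradient f x) x := by
  filter_upwards [hf.ae_differentiableAt (μ := volume)] with x hx
  exact hx.hasGradientAt

end Gradient

/-! ### Products and compositions of Lipschitz functions -/

section Lipschitz

variable {α : Type*} [PseudoMetricSpace α]

theorem lipschitz_of_abs_sub_le {f : α → ℝ} {K : ℝ}
    (h : ∀ x y, |f x - f y| ≤ K * dist x y) : ∃ L, LipschitzWith L f :=
  ⟨K.toNNReal, LipschitzWith.of_dist_le' fun x y => by rw [Real.dist_eq]; exact h x y⟩

theorem exists_lipschitzWith_mul {f g : α → ℝ} {K L : NNReal} {A B : ℝ}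
    (hf : LipschitzWith K f) (hg : LipschitzWith L g) (hfA : ∀ x, |f x| ≤ A)
    (hgB : ∀ x, |g x| ≤ B) : ∃ M, LipschitzWith M fun x => f x * g x := by
  refine lipschitz_of_abs_sub_le (K := A * L + B * K) fun x y => ?_
  have h1 : f x * g x - f y * g y = f x * (g x - g y) + g y * (f x - f y) := by ring
  have h2 := hf.dist_le_mul x y
  have h3 := hg.dist_le_mul x y
  rw [Real.dist_eq] at h2 h3
  rw [h1]
  refine (abs_add_le _ _).trans ?_
  rw [abs_mul, abs_mul]
  have hA := (abs_nonneg _).trans (hfA x)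
  have hB := (abs_nonneg _).trans (hgB x)
  have h4 : |f x| * |g x - g y| ≤ A * (L * dist x y) :=
    mul_le_mul (hfA x) h3 (abs_nonneg _) hA
  have h5 : |g y| * |f x - f y| ≤ B * (K * dist x y) :=
    mul_le_mul (hgB y) h2 (abs_nonneg _) hB
  linarith

theorem exists_lipschitzWith_comp {f : α → ℝ} {K : NNReal} {φ φ' : ℝ → ℝ} {s t : ℝ}
    (hf : LipschitzWith K f) (hst : ∀ x, f x ∈ Set.Icc s t)
    (hφ : ∀ y ∈ Set.Icc s t, HasDerivAt φ (φ' y) y) (hφ' : ContinuousOn φ' (Set.Icc s t)) :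
    ∃ M, LipschitzWith M fun x => φ (f x) := by
  obtain ⟨C, hC⟩ := isCompact_Icc.exists_bound_of_continuousOn hφ'
  refine lipschitz_of_abs_sub_le (K := C * K) fun x y => ?_
  have h1 := (convex_Icc s t).norm_image_sub_le_of_norm_hasDerivWithin_le
    (fun z hz => (hφ z hz).hasDerivWithinAt) hC (hst y) (hst x)
  have h2 := hf.dist_le_mul x y
  rw [Real.dist_eq] at h2
  have hC0 : 0 ≤ C := (norm_nonneg _).trans (hC _ (hst x))
  refine h1.trans ?_
  rw [mul_assoc]
  exact mul_le_mul_of_nonneg_left h2 hC0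

end Lipschitz

/-! ### Mollification of Lipschitz functions -/

section Mollification

variable {n : ℕ}

/-- Bump functions at the origin with supports shrinking to the origin. -/
def bump (n k : ℕ) : ContDiffBump (0 : Rn n) where
  rIn := 1 / (2 * (k + 1))
  rOut := 1 / (k + 1)
  rIn_pos := by positivity
  rIn_lt_rOut := by
    apply one_div_lt_one_div_of_lt
    · positivity
    · have : (0 : ℝ) ≤ k := k.cast_nonneg
      linarith

theorem tendsto_bump_rOut (n : ℕ) : Tendsto (fun k => (bump n k).rOut) atTop (𝓝 0) :=
  tendsto_one_div_add_atTop_nhds_zero_nat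

/-- Mollification of `f` at scale `1 / (k + 1)`. -/
def mollify (f : Rn n → ℝ) (k : ℕ) : Rn n → ℝ :=
  MeasureTheory.convolution ((bump n k).normed volume) f (ContinuousLinearMap.lsmul ℝ ℝ) volume

theorem mollify_apply (f : Rn n → ℝ) (k : ℕ) (x : Rn n) :
    mollify f k x = ∫ t, (bump n k).normed volume t * f (x - t) := by
  simp [mollify, MeasureTheory.convolution]

theorem contDiff_mollify {f : Rn n → ℝ} (hf : Continuous f) (k : ℕ) :
    ContDiff ℝ ∞ (mollify f k) :=
  (bump n k).hasCompactSupport_normed.contDiff_convolution_left _ (bump n k).contDiff_normed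
    hf.locallyIntegrable

theorem tendsto_mollify {f : Rn n → ℝ} (hf : Continuous f) (x : Rn n) :
    Tendsto (fun k => mollify f k x) atTop (𝓝 (f x)) :=
  ContDiffBump.convolution_tendsto_right_of_continuous (tendsto_bump_rOut n) hf x

theorem integrable_bump_mul {f : Rn n → ℝ} (hf : Continuous f) (k : ℕ) (x : Rn n) :
    Integrable (fun t => (bump n k).normed volume t * f (x - t)) := by
  apply Continuous.integrable_of_hasCompactSupport
  · exact ((bump n k).contDiff_normed (n := 0)).continuous.mul (by fun_prop)
  · exact (bump n k).hasCompactSupport_normed.mul_right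

theorem mollify_nonneg {f : Rn n → ℝ} (hf : ∀ x, 0 ≤ f x) (k : ℕ) (x : Rn n) :
    0 ≤ mollify f k x := by
  rw [mollify_apply]
  exact integral_nonneg fun t => mul_nonneg ((bump n k).nonneg_normed t) (hf _)

theorem abs_mollify_le {f : Rn n → ℝ} (hf : Continuous f) {M : ℝ} (hM : ∀ x, |f x| ≤ M)
    (k : ℕ) (x : Rn n) : |mollify f k x| ≤ M := by
  rw [mollify_apply]
  calc |∫ t, (bump n k).normed volume t * f (x - t)|
      ≤ ∫ t, |(bump n k).normed volume t * f (x - t)| := abs_integral_le_integral_abs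
    _ ≤ ∫ t, (bump n k).normed volume t * M := by
        apply integral_mono (integrable_bump_mul hf k x).abs
        · exact (bump n k).integrable_normed.mul_const M
        · intro t
          simp only
          rw [abs_mul, abs_of_nonneg ((bump n k).nonneg_normed t)]
          exact mul_le_mul_of_nonneg_left (hM _) ((bump n k).nonneg_normed t)
    _ = M := by rw [integral_mul_const, (bump n k).integral_normed, one_mul]

theorem lipschitz_mollify {f : Rn n → ℝ} {K : NNReal} (hf : LipschitzWith K f) (k : ℕ) :
    LipschitzWith K (mollify f k) := by
  refine LipschitzWith.of_dist_le_mul fun x y => ?_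
  rw [Real.dist_eq, mollify_apply, mollify_apply,
    ← integral_sub (integrable_bump_mul hf.continuous k x) (integrable_bump_mul hf.continuous k y)]
  calc |∫ t, ((bump n k).normed volume t * f (x - t) - (bump n k).normed volume t * f (y - t))|
      ≤ ∫ t, |(bump n k).normed volume t * f (x - t) - (bump n k).normed volume t * f (y - t)| :=
        abs_integral_le_integral_abs
    _ ≤ ∫ t, (bump n k).normed volume t * (K * dist x y) := by
        apply integral_mono
        · exact ((integrable_bump_mul hf.continuous k x).sub
            (integrable_bump_mul hf.continuous k y)).abs
        · exact (bump n k).integrable_normed.mul_const _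
        · intro t
          simp only
          rw [← mul_sub, abs_mul, abs_of_nonneg ((bump n k).nonneg_normed t)]
          refine mul_le_mul_of_nonneg_left ?_ ((bump n k).nonneg_normed t)
          have := hf.dist_le_mul (x - t) (y - t)
          rwa [dist_sub_right, Real.dist_eq] at this
    _ = K * dist x y := by rw [integral_mul_const, (bump n k).integral_normed, one_mul]

theorem mollify_eq_zero {f : Rn n → ℝ} {r : ℝ} (hf : ∀ x, r ≤ ‖x‖ → f x = 0) (k : ℕ) {x : Rn n}
    (hx : r + 1 ≤ ‖x‖) : mollify f k x = 0 := by
  rw [mollify_apply]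
  refine integral_eq_zero_of_ae (Eventually.of_forall fun t => ?_)
  simp only [Pi.zero_apply, mul_eq_zero]
  by_cases ht : t ∈ Function.support ((bump n k).normed (volume : Measure (Rn n)))
  · right
    rw [(bump n k).support_normed_eq, mem_ball_zero_iff] at ht
    apply hf
    have h1 : (bump n k).rOut ≤ 1 := by
      have : (1 : ℝ) ≤ k + 1 := by have := k.cast_nonneg (α := ℝ); linarith
      simpa [bump] using inv_le_one_of_one_le₀ this
    have := norm_sub_norm_le x t
    linarith
  · left
    simpa using ht

/-- The derivative is placed on `f`, not on the kernel. By Rademacher the integrand is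
differentiable at `x` for a.e. `t`, and the Lipschitz constant supplies the domination. -/
theorem hasFDerivAt_mollify {f : Rn n → ℝ} {K : NNReal} (hf : LipschitzWith K f) (k : ℕ)
    (x : Rn n) :
    HasFDerivAt (mollify f k) (MeasureTheory.convolution ((bump n k).normed volume) (fderiv ℝ f)
      (ContinuousLinearMap.lsmul ℝ ℝ) volume x) x := by
  have hm : mollify f k = fun x => ∫ t, (bump n k).normed volume t * f (x - t) := by
    ext x; exact mollify_apply f k x
  rw [hm]
  have hc : Continuous ((bump n k).normed (volume : Measure (Rn n))) :=
    ((bump n k).contDiff_normed (n := 0)).continuous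
  have hfc := hf.continuous
  refine (hasFDerivAt_integral_of_dominated_loc_of_lip (s := Set.univ)
    (bound := fun t => (bump n k).normed volume t * K)
    (F' := fun t => (bump n k).normed volume t • fderiv ℝ f (x - t)) univ_mem ?_ ?_ ?_ ?_ ?_ ?_).2
  · exact Eventually.of_forall fun y => (integrable_bump_mul hfc k y).aestronglyMeasurable
  · exact integrable_bump_mul hfc k x
  · exact (hc.measurable.smul ((measurable_fderiv ℝ f).comp
      (measurable_const.sub measurable_id))).aestronglyMeasurable
  · refine Eventually.of_forall fun t => LipschitzWith.lipschitzOnWith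
      (LipschitzWith.of_dist_le_mul fun y z => ?_)
    rw [Real.dist_eq, ← mul_sub, abs_mul, Real.coe_nnabs,
      abs_mul, mul_assoc]
    refine mul_le_mul_of_nonneg_left ?_ (abs_nonneg _)
    have := hf.dist_le_mul (y - t) (z - t)
    rwa [dist_sub_right, Real.dist_eq, ← abs_of_nonneg K.coe_nonneg] at this
  · exact (bump n k).integrable_normed.mul_const _
  · have h1 := hf.ae_differentiableAt (μ := (volume : Measure (Rn n)))
    have h2 : ∀ᵐ t ∂(volume : Measure (Rn n)), DifferentiableAt ℝ f (x - t) :=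
      (quasiMeasurePreserving_sub_left_of_right_invariant volume x).ae h1
    filter_upwards [h2] with t ht
    have h3 : HasFDerivAt (fun y => f (y - t)) (fderiv ℝ f (x - t)) x := by
      rw [hasFDerivAt_comp_sub]
      exact ht.hasFDerivAt
    exact h3.const_mul _

theorem locallyIntegrable_fderiv {f : Rn n → ℝ} {K : NNReal} (hf : LipschitzWith K f) :
    LocallyIntegrable (fderiv ℝ f) (volume : Measure (Rn n)) := by
  refine (locallyIntegrable_const (K : ℝ)).mono (measurable_fderiv ℝ f).aestronglyMeasurable
    (Eventually.of_forall fun x => ?_)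
  rw [Real.norm_of_nonneg K.coe_nonneg]
  exact norm_fderiv_le_of_lipschitz ℝ hf

theorem ae_tendsto_fderiv_mollify {f : Rn n → ℝ} {K : NNReal} (hf : LipschitzWith K f) :
    ∀ᵐ x ∂(volume : Measure (Rn n)),
      Tendsto (fun k => fderiv ℝ (mollify f k) x) atTop (𝓝 (fderiv ℝ f x)) := by
  -- This is Lebesgue differentiation, which requires the ratio of outer to inner radius of the
  -- bumps to stay bounded; here it is always 2.
  have h := ContDiffBump.ae_convolution_tendsto_right_of_locallyIntegrable (K := 2)
    (tendsto_bump_rOut n) (Eventually.of_forall fun k => ?_) (locallyIntegrable_fderiv hf)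
  · filter_upwards [h] with x hx
    simpa only [(hasFDerivAt_mollify hf _ x).fderiv] using hx
  · simp only [bump]
    rw [mul_one_div, ← mul_div_mul_left 1 _ (two_ne_zero (α := ℝ))]
    simp

theorem ae_tendsto_gradient_mollify {f : Rn n → ℝ} {K : NNReal} (hf : LipschitzWith K f) :
    ∀ᵐ x ∂(volume : Measure (Rn n)),
      Tendsto (fun k => gradient (mollify f k) x) atTop (𝓝 (gradient f x)) := by
  filter_upwards [ae_tendsto_fderiv_mollify hf] with x hx
  exact ((InnerProductSpace.toDual ℝ (Rn n)).symm.continuous.tendsto _).comp hx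

end Mollification

/-! ### The bilinear form of the coefficient matrix -/

section Form

variable {n : ℕ}

/-- The bilinear form `m_ij p_j q_i` of a matrix `m`. -/
def aform (m : Matrix (Fin n) (Fin n) ℝ) (p q : Rn n) : ℝ := ∑ i, ∑ j, m i j * p j * q i

theorem aform_smul_left (m : Matrix (Fin n) (Fin n) ℝ) (c : ℝ) (p q : Rn n) :
    aform m (c • p) q = c * aform m p q := by
  simp only [aform, Finset.mul_sum, PiLp.smul_apply, smul_eq_mul]
  exact Finset.sum_congr rfl fun i _ => Finset.sum_congr rfl fun j _ => by ring

theorem aform_smul_right (m : Matrix (Fin n) (Fin n) ℝ) (c : ℝ) (p q : Rn n) :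
    aform m p (c • q) = c * aform m p q := by
  simp only [aform, Finset.mul_sum, PiLp.smul_apply, smul_eq_mul]
  exact Finset.sum_congr rfl fun i _ => Finset.sum_congr rfl fun j _ => by ring

theorem aform_add_right (m : Matrix (Fin n) (Fin n) ℝ) (p q r : Rn n) :
    aform m p (q + r) = aform m p q + aform m p r := by
  simp only [aform, ← Finset.sum_add_distrib, PiLp.add_apply]
  exact Finset.sum_congr rfl fun i _ => Finset.sum_congr rfl fun j _ => by ring

theorem abs_aform_le {m : Matrix (Fin n) (Fin n) ℝ} {c : ℝ} (hm : ∀ i j, |m i j| ≤ c)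
    (p q : Rn n) : |aform m p q| ≤ n ^ 2 * c * ‖p‖ * ‖q‖ := by
  have h (i j : Fin n) : |m i j * p j * q i| ≤ c * ‖p‖ * ‖q‖ := by
    have hp := PiLp.norm_apply_le p j
    have hq := PiLp.norm_apply_le q i
    rw [Real.norm_eq_abs] at hp hq
    have hc := (abs_nonneg _).trans (hm i j)
    rw [abs_mul, abs_mul]
    gcongr
    exact hm i j
  calc |aform m p q| ≤ ∑ i, |∑ j, m i j * p j * q i| := Finset.abs_sum_le_sum_abs _ _
    _ ≤ ∑ i : Fin n, ∑ j : Fin n, |m i j * p j * q i| :=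
        Finset.sum_le_sum fun i _ => Finset.abs_sum_le_sum_abs _ _
    _ ≤ ∑ i : Fin n, ∑ j : Fin n, c * ‖p‖ * ‖q‖ :=
        Finset.sum_le_sum fun i _ => Finset.sum_le_sum fun j _ => h i j
    _ = n ^ 2 * c * ‖p‖ * ‖q‖ := by
        simp only [Finset.sum_const, Finset.card_univ, Fintype.card_fin, nsmul_eq_mul]
        ring

theorem weakForm_eq (a : Rn n → Matrix (Fin n) (Fin n) ℝ) (b : Rn n → Rn n) (u η : Rn n → ℝ) :
    weakForm a b u η =
      ∫ x, (aform (a x) (gradient u x) (gradient η x) + inner ℝ (b x) (gradient u x) * η x) := by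
  simp only [weakForm, aform, gradient_apply, PiLp.inner_apply, RCLike.inner_apply, conj_trivial,
    mul_comm]

theorem sum_mul_pd_eq (b : Rn n → Rn n) (φ : Rn n → ℝ) (x : Rn n) :
    ∑ i, b x i * pd i φ x = inner ℝ (b x) (gradient φ x) := by
  simp only [gradient_apply, PiLp.inner_apply, RCLike.inner_apply, conj_trivial, mul_comm]

end Form

/-! ### The divergence condition for Lipschitz test functions -/

section Divergence

variable {n : ℕ}

/-- The hypothesis on div b only speaks of smooth test functions, whereas the proof tests with
functions of `w`. Mollifications are admissible, their gradients converge a.e., and K|b| on a fixed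
ball dominates. -/
theorem integral_inner_gradient_nonneg {b : Rn n → Rn n}
    (hb : LocallyIntegrable b (volume : Measure (Rn n)))
    (hdiv : DivNonpos b) {φ : Rn n → ℝ} (hφ : IsTest φ) :
    0 ≤ ∫ x, inner ℝ (b x) (gradient φ x) := by
  obtain ⟨⟨K, hK⟩, hsupp, hnn⟩ := hφ
  obtain ⟨r, hr⟩ : ∃ r : ℝ, ∀ x, r ≤ ‖x‖ → φ x = 0 := by
    obtain ⟨r, hr⟩ := hsupp.isCompact.isBounded.subset_ball (0 : Rn n)
    refine ⟨r, fun x hx => image_eq_zero_of_notMem_tsupport fun h => ?_⟩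
    have := mem_ball_zero_iff.1 (hr h)
    linarith
  have hlim : Tendsto (fun k => ∫ x, inner ℝ (b x) (gradient (mollify φ k) x)) atTop
      (𝓝 (∫ x, inner ℝ (b x) (gradient φ x))) := by
    refine tendsto_integral_of_dominated_convergence
      (Set.indicator (Metric.closedBall 0 (r + 1)) fun x => ‖b x‖ * K) ?_ ?_ ?_ ?_
    · intro k
      exact hb.aestronglyMeasurable.inner (measurable_gradient _).aestronglyMeasurable
    · rw [integrable_indicator_iff Metric.isClosed_closedBall.measurableSet]
      exact (hb.integrableOn_isCompact (isCompact_closedBall _ _)).norm.mul_const _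
    · intro k
      refine Eventually.of_forall fun x => ?_
      by_cases hx : x ∈ Metric.closedBall (0 : Rn n) (r + 1)
      · rw [Set.indicator_of_mem hx]
        exact (norm_inner_le_norm _ _).trans
          (mul_le_mul_of_nonneg_left (norm_gradient_le (lipschitz_mollify hK k) x) (norm_nonneg _))
      · rw [Set.indicator_of_notMem hx]
        rw [mem_closedBall_zero_iff, not_le] at hx
        rw [gradient_eq_zero_of_nonneg (mollify_nonneg hnn k) (mollify_eq_zero hr k hx.le)]
        simp
    · filter_upwards [ae_tendsto_gradient_mollify hK] with x hx
      exact tendsto_const_nhds.inner hx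
  refine ge_of_tendsto' hlim fun k => ?_
  have h := hdiv (mollify φ k) (contDiff_mollify hK.continuous k) ?_ (mollify_nonneg hnn k)
  · simp only [distDiv, sum_mul_pd_eq] at h
    linarith
  · refine HasCompactSupport.of_support_subset_isCompact
      (isCompact_closedBall (0 : Rn n) (r + 1)) fun x hx => ?_
    by_contra h
    rw [mem_closedBall_zero_iff, not_le] at h
    exact hx (mollify_eq_zero hr k h.le)

end Divergence

/-! ### Sobolev's inequality on the unit ball -/

section Sobolev

variable {n : ℕ}

/-- Lebesgue measure on the open unit ball. -/
abbrev ballMeasure (n : ℕ) : Measure (Rn n) := volume.restrict (Metric.ball 0 1)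

instance (n : ℕ) : IsFiniteMeasure (ballMeasure n) :=
  ⟨by rw [Measure.restrict_apply_univ]; exact measure_ball_lt_top⟩

theorem integral_ballMeasure {f : Rn n → ℝ} (hf : ∀ x, 1 ≤ ‖x‖ → f x = 0) :
    ∫ x, f x ∂(ballMeasure n) = ∫ x, f x := by
  refine setIntegral_eq_integral_of_forall_compl_eq_zero fun x hx => hf x ?_
  simpa using hx

theorem integrable_ballMeasure_of_bound {f : Rn n → ℝ} (hf : AEStronglyMeasurable f (ballMeasure n))
    {C : ℝ} (hC : ∀ x, |f x| ≤ C) : Integrable f (ballMeasure n) :=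
  Integrable.of_bound hf C (Eventually.of_forall hC)

/-- Since σ is strictly subcritical for L_2 gradients, some exponent P < 2 already controls the L_σ
norm, and Hölder on a bounded set passes from L_P to L_2. Taking P < 2 ≤ n also covers n = 2. The
support may reach radius 2 because mollifying a function on the unit ball enlarges its support. -/
theorem sobolev_of_contDiff (hn : 2 ≤ n) {σ : ℝ} (hσ : 0 < σ) (hσn : 1 / 2 - 1 / (n : ℝ) < 1 / σ) :
    ∃ C : ℝ, 0 < C ∧ ∀ f : Rn n → ℝ, ContDiff ℝ 1 f → (∀ x, 2 ≤ ‖x‖ → f x = 0) →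
      (∫ x, |f x| ^ σ) ^ (1 / σ) ≤ C * (∫ x, ‖gradient f x‖ ^ 2) ^ (1 / 2 : ℝ) := by
  have hn0 : (2 : ℝ) ≤ n := by exact_mod_cast hn
  -- This is the exponent whose Sobolev conjugate is σ, raised to 1 if it falls below.
  set P : ℝ := max 1 (1 / (n : ℝ) + 1 / σ)⁻¹ with hP
  have hP1 : 1 ≤ P := le_max_left _ _
  have hpos : 0 < 1 / (n : ℝ) + 1 / σ := by positivity
  have hP2 : P < 2 := by
    refine max_lt one_lt_two ?_
    rw [inv_lt_comm₀ hpos two_pos]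
    linarith
  have hPinv : P⁻¹ ≤ 1 / (n : ℝ) + 1 / σ := by
    rw [inv_le_comm₀ (by positivity) hpos]
    exact le_max_right _ _
  let p : NNReal := ⟨P, by positivity⟩
  let r : NNReal := ⟨σ, hσ.le⟩
  let S : Set (Rn n) := Metric.closedBall 0 2
  set C₀ : NNReal := eLpNormLESNormFDerivOfLeConst ℝ (volume : Measure (Rn n)) S p r
  set D : ENNReal := volume S ^ (1 / P - 1 / 2)
  have hD : D ≠ ⊤ := by
    refine ENNReal.rpow_ne_top_of_nonneg ?_ (measure_closedBall_lt_top).ne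
    rw [sub_nonneg]
    exact one_div_le_one_div_of_le (by positivity) hP2.le
  refine ⟨C₀ * D.toReal + 1, by positivity, fun f hf hf0 => ?_⟩
  have hsupp : f.support ⊆ S := fun x hx => by
    by_contra h
    rw [mem_closedBall_zero_iff, not_le] at h
    exact hx (hf0 x h.le)
  have hcs : HasCompactSupport f :=
    HasCompactSupport.of_support_subset_isCompact (isCompact_closedBall _ _) hsupp
  have hcs' : HasCompactSupport (fderiv ℝ f) := hcs.fderiv (𝕜 := ℝ)
  have hcont : Continuous (fderiv ℝ f) := hf.continuous_fderiv one_ne_zero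
  have hsupp' : (fderiv ℝ f).support ⊆ S :=
    (support_fderiv_subset ℝ).trans (closure_minimal hsupp Metric.isClosed_closedBall)
  have h1 := eLpNorm_le_eLpNorm_fderiv_of_le (volume : Measure (Rn n)) hf hsupp (p := p) (q := r)
    (by exact_mod_cast hP1) ?_ ?_ Metric.isBounded_closedBall
  · have h2 : eLpNorm (fderiv ℝ f) p volume ≤ eLpNorm (fderiv ℝ f) 2 volume * D := by
      have e (t : ENNReal) : eLpNorm (fderiv ℝ f) t (volume.restrict S) =
          eLpNorm (fderiv ℝ f) t volume :=
        eLpNorm_restrict_eq_of_support_subset (ε := Rn n →L[ℝ] ℝ) hsupp'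
      rw [← e, ← e]
      refine (eLpNorm_le_eLpNorm_mul_rpow_measure_univ (p := p) (q := 2) ?_
        hcont.aestronglyMeasurable).trans_eq ?_
      · have : p ≤ 2 := by exact_mod_cast hP2.le
        exact_mod_cast this
      · rw [Measure.restrict_apply_univ]
        rfl
    have m1 : MemLp f r volume := hf.continuous.memLp_of_hasCompactSupport hcs
    have m2 : MemLp (fderiv ℝ f) 2 volume := hcont.memLp_of_hasCompactSupport hcs'
    have h3 : eLpNorm f r volume = ENNReal.ofReal ((∫ x, |f x| ^ σ) ^ (1 / σ)) := by
      rw [m1.eLpNorm_eq_integral_rpow_norm (by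
        simp only [ne_eq, ENNReal.coe_eq_zero]; exact fun h => hσ.ne' (congrArg NNReal.toReal h))
        ENNReal.coe_ne_top]
      simp only [ENNReal.coe_toReal, one_div, Real.norm_eq_abs]
      rfl
    have h4 : eLpNorm (fderiv ℝ f) 2 volume =
        ENNReal.ofReal ((∫ x, ‖gradient f x‖ ^ 2) ^ (1 / 2 : ℝ)) := by
      rw [m2.eLpNorm_eq_integral_rpow_norm two_ne_zero ENNReal.ofNat_ne_top]
      simp [norm_gradient]
    rw [h3] at h1
    have h5 : ENNReal.ofReal ((∫ x, |f x| ^ σ) ^ (1 / σ)) ≤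
        ENNReal.ofReal (C₀ * D.toReal * (∫ x, ‖gradient f x‖ ^ 2) ^ (1 / 2 : ℝ)) := by
      refine h1.trans ?_
      rw [ENNReal.ofReal_mul (by positivity), ENNReal.ofReal_mul (by positivity),
        ENNReal.ofReal_toReal hD, ENNReal.ofReal_coe_nnreal, ← h4, mul_assoc, mul_comm D]
      gcongr
    have h6 : 0 ≤ (∫ x, ‖gradient f x‖ ^ 2) ^ (1 / 2 : ℝ) :=
      Real.rpow_nonneg (integral_nonneg fun x => by positivity) _
    have h7 := (ENNReal.ofReal_le_ofReal_iff (by positivity)).1 h5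
    linarith
  · rw [finrank_euclideanSpace_fin]
    have : P < n := hP2.trans_le hn0
    exact_mod_cast this
  · rw [finrank_euclideanSpace_fin]
    change P⁻¹ - (n : ℝ)⁻¹ ≤ σ⁻¹
    simp only [one_div] at hPinv
    linarith

/-- Sobolev's inequality for nonnegative Lipschitz functions vanishing outside the unit ball. -/
theorem sobolev_of_lipschitz (hn : 2 ≤ n) {σ : ℝ} (hσ : 0 < σ)
    (hσn : 1 / 2 - 1 / (n : ℝ) < 1 / σ) :
    ∃ C : ℝ, 0 < C ∧ ∀ (f : Rn n → ℝ) (K : NNReal), LipschitzWith K f → (∀ x, 0 ≤ f x) →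
      (∀ x, 1 ≤ ‖x‖ → f x = 0) →
      (∫ x, f x ^ σ ∂(ballMeasure n)) ^ (2 / σ) ≤ C * ∫ x, ‖gradient f x‖ ^ 2 ∂(ballMeasure n) := by
  obtain ⟨C, hC0, hC⟩ := sobolev_of_contDiff hn hσ hσn
  refine ⟨C ^ 2, by positivity, fun f K hf hnn hf0 => ?_⟩
  have hcs : HasCompactSupport f := HasCompactSupport.of_support_subset_isCompact
    (isCompact_closedBall (0 : Rn n) 1) fun x hx => by
      by_contra h
      rw [mem_closedBall_zero_iff, not_le] at h
      exact hx (hf0 x h.le)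
  obtain ⟨M, hM⟩ := hcs.exists_bound_of_continuous hf.continuous
  simp only [Real.norm_eq_abs] at hM
  have hM0 : 0 ≤ M := (abs_nonneg _).trans (hM 0)
  have hz (k : ℕ) (x : Rn n) (hx : 2 ≤ ‖x‖) : mollify f k x = 0 :=
    mollify_eq_zero hf0 k (by linarith)
  have hint (c : ℝ) : Integrable (Set.indicator (Metric.closedBall (0 : Rn n) 2) fun _ => c) := by
    rw [integrable_indicator_iff Metric.isClosed_closedBall.measurableSet]
    exact integrableOn_const measure_closedBall_lt_top.ne
  have h1 : Tendsto (fun k => ∫ x, |mollify f k x| ^ σ) atTop (𝓝 (∫ x, |f x| ^ σ)) := by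
    refine tendsto_integral_of_dominated_convergence
      (Set.indicator (Metric.closedBall 0 2) fun x => M ^ σ) (fun k => ?_) (hint _) (fun k => ?_) ?_
    · exact (((contDiff_mollify hf.continuous k).continuous.abs.rpow_const
        fun _ => Or.inr hσ.le)).aestronglyMeasurable
    · refine Eventually.of_forall fun x => ?_
      rw [Real.norm_of_nonneg (by positivity)]
      by_cases hx : x ∈ Metric.closedBall (0 : Rn n) 2
      · rw [Set.indicator_of_mem hx]
        exact Real.rpow_le_rpow (abs_nonneg _) (abs_mollify_le hf.continuous hM k x) hσ.le
      · rw [Set.indicator_of_notMem hx]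
        rw [mem_closedBall_zero_iff, not_le] at hx
        rw [hz k x hx.le, abs_zero, Real.zero_rpow hσ.ne']
    · refine Eventually.of_forall fun x => ?_
      exact ((tendsto_mollify hf.continuous x).abs).rpow_const (Or.inr hσ.le)
  have h2 : Tendsto (fun k => ∫ x, ‖gradient (mollify f k) x‖ ^ 2) atTop
      (𝓝 (∫ x, ‖gradient f x‖ ^ 2)) := by
    refine tendsto_integral_of_dominated_convergence
      (Set.indicator (Metric.closedBall 0 2) fun x => (K : ℝ) ^ 2) (fun k => ?_) (hint _)
      (fun k => ?_) ?_
    · exact ((measurable_gradient _).norm.pow_const 2).aestronglyMeasurable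
    · refine Eventually.of_forall fun x => ?_
      rw [Real.norm_of_nonneg (by positivity)]
      by_cases hx : x ∈ Metric.closedBall (0 : Rn n) 2
      · rw [Set.indicator_of_mem hx]
        exact pow_le_pow_left₀ (norm_nonneg _) (norm_gradient_le (lipschitz_mollify hf k) x) 2
      · rw [Set.indicator_of_notMem hx]
        rw [mem_closedBall_zero_iff, not_le] at hx
        rw [gradient_eq_zero_of_nonneg (mollify_nonneg hnn k) (hz k x hx.le)]
        simp
    · filter_upwards [ae_tendsto_gradient_mollify hf] with x hx
      exact hx.norm.pow 2
  have h3 : (∫ x, |f x| ^ σ) ^ (1 / σ) ≤ C * (∫ x, ‖gradient f x‖ ^ 2) ^ (1 / 2 : ℝ) := by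
    refine le_of_tendsto_of_tendsto' (h1.rpow_const (Or.inr (by positivity)))
      ((h2.rpow_const (Or.inr (by positivity))).const_mul C) fun k => ?_
    exact hC _ ((contDiff_mollify hf.continuous k).of_le (by exact_mod_cast le_top)) (hz k)
  have e1 : ∫ x, f x ^ σ ∂(ballMeasure n) = ∫ x, |f x| ^ σ := by
    rw [integral_ballMeasure fun x hx => by rw [hf0 x hx, Real.zero_rpow hσ.ne']]
    simp only [abs_of_nonneg (hnn _)]
  have e2 : ∫ x, ‖gradient f x‖ ^ 2 ∂(ballMeasure n) = ∫ x, ‖gradient f x‖ ^ 2 :=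
    integral_ballMeasure fun x hx => by
      rw [gradient_eq_zero_of_nonneg hnn (hf0 x hx)]; simp
  rw [e1, e2]
  have i1 : 0 ≤ ∫ x, |f x| ^ σ := integral_nonneg fun x => by positivity
  have i2 : 0 ≤ ∫ x, ‖gradient f x‖ ^ 2 := integral_nonneg fun x => by positivity
  calc (∫ x, |f x| ^ σ) ^ (2 / σ) = ((∫ x, |f x| ^ σ) ^ (1 / σ)) ^ 2 := by
        rw [← Real.rpow_natCast, ← Real.rpow_mul i1]
        congr 1
        push_cast
        ring
    _ ≤ (C * (∫ x, ‖gradient f x‖ ^ 2) ^ (1 / 2 : ℝ)) ^ 2 :=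
        pow_le_pow_left₀ (by positivity) h3 2
    _ = C ^ 2 * ∫ x, ‖gradient f x‖ ^ 2 := by
        rw [mul_pow, ← Real.sqrt_eq_rpow, Real.sq_sqrt i2]

end Sobolev

/-! ### The conical cutoff -/

section Cone

variable {n : ℕ}

/-- The cutoff function `(1 - |x|)₊`. -/
def cone (x : Rn n) : ℝ := max (1 - ‖x‖) 0

theorem cone_nonneg (x : Rn n) : 0 ≤ cone x := le_max_right _ _

theorem cone_le_one (x : Rn n) : cone x ≤ 1 :=
  max_le (by linarith [norm_nonneg x]) zero_le_one

theorem cone_eq_zero {x : Rn n} (hx : 1 ≤ ‖x‖) : cone x = 0 :=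
  max_eq_right (by linarith)

theorem cone_eq {x : Rn n} (hx : ‖x‖ ≤ 1) : cone x = 1 - ‖x‖ :=
  max_eq_left (by linarith)

theorem lipschitzWith_cone : LipschitzWith 1 (cone : Rn n → ℝ) := by
  refine LipschitzWith.max_const (LipschitzWith.of_dist_le_mul fun x y => ?_) 0
  rw [Real.dist_eq, dist_eq_norm, NNReal.coe_one, one_mul]
  have h : 1 - ‖x‖ - (1 - ‖y‖) = ‖y‖ - ‖x‖ := by ring
  rw [h, abs_sub_comm]
  exact abs_norm_sub_norm_le x y

/-- The cutoff is concave on the unit ball and at least 1/2 at `y`, so along the segment towards `y`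
it cannot drop below half of its value at `x`. This is what lets the Poincaré inequality carry the
same weight on both sides. -/
theorem cone_le_two_mul {x y : Rn n} (hx : ‖x‖ ≤ 1) (hy : ‖y‖ ≤ 1 / 2) {t : ℝ} (ht : 0 ≤ t)
    (ht1 : t ≤ 1) : cone x ≤ 2 * cone (x + t • (y - x)) := by
  have h1 : x + t • (y - x) = (1 - t) • x + t • y := by
    rw [smul_sub, sub_smul, one_smul]; abel
  have h2 : ‖x + t • (y - x)‖ ≤ (1 - t) * ‖x‖ + t * ‖y‖ := by
    rw [h1]
    refine (norm_add_le _ _).trans ?_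
    rw [norm_smul, norm_smul, Real.norm_of_nonneg ht, Real.norm_of_nonneg (by linarith)]
  have h3 : 1 - ‖x + t • (y - x)‖ ≤ cone (x + t • (y - x)) := le_max_left _ _
  rw [cone_eq hx]
  nlinarith [norm_nonneg x, mul_le_mul_of_nonneg_left hy ht,
    mul_nonneg (sub_nonneg.2 ht1) (sub_nonneg.2 hx), mul_nonneg ht (norm_nonneg x)]

end Cone

/-! ### A weighted Poincaré inequality -/

section Poincare

variable {n : ℕ}

/-- The fundamental theorem of calculus on the segment, followed by Jensen's inequality for the
square. -/
theorem sq_sub_le_integral_segment {w : Rn n → ℝ} (hw : ContDiff ℝ 1 w) (x y : Rn n) :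
    (w x - w y) ^ 2 ≤
      ‖x - y‖ ^ 2 * ∫ t in Set.Ioc (0 : ℝ) 1, ‖gradient w (x + t • (y - x))‖ ^ 2 := by
  have hc : Continuous (fderiv ℝ w) := hw.continuous_fderiv one_ne_zero
  have hline : Continuous fun t : ℝ => x + t • (y - x) := by fun_prop
  set φ' : ℝ → ℝ := fun t => fderiv ℝ w (x + t • (y - x)) (y - x)
  have hφ' : Continuous φ' := (hc.comp hline).clm_apply continuous_const
  have h1 : ∫ t in Set.Ioc (0 : ℝ) 1, φ' t = w y - w x := by
    rw [← intervalIntegral.integral_of_le zero_le_one]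
    rw [intervalIntegral.integral_eq_sub_of_hasDerivAt (f := fun t : ℝ => w (x + t • (y - x)))]
    · simp
    · intro t _
      have h2 : HasDerivAt (fun t : ℝ => x + t • (y - x)) (y - x) t := by
        simpa using ((hasDerivAt_id t).smul_const (y - x)).const_add x
      exact ((hw.differentiable one_ne_zero _).hasFDerivAt).comp_hasDerivAt t h2
    · exact hφ'.intervalIntegrable _ _
  have : IsProbabilityMeasure (volume.restrict (Set.Ioc (0 : ℝ) 1)) :=
    ⟨by rw [Measure.restrict_apply_univ]; simp⟩
  have h2 : (∫ t in Set.Ioc (0 : ℝ) 1, φ' t) ^ 2 ≤ ∫ t in Set.Ioc (0 : ℝ) 1, φ' t ^ 2 :=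
    (even_two.convexOn_pow (𝕜 := ℝ)).map_integral_le (by fun_prop) isClosed_univ
      (Eventually.of_forall fun _ => Set.mem_univ _) (hφ'.integrableOn_Ioc)
      ((hφ'.pow 2).integrableOn_Ioc)
  have h3 : ∫ t in Set.Ioc (0 : ℝ) 1, φ' t ^ 2 ≤
      ∫ t in Set.Ioc (0 : ℝ) 1, ‖x - y‖ ^ 2 * ‖gradient w (x + t • (y - x))‖ ^ 2 := by
    apply integral_mono (hφ'.pow 2).integrableOn_Ioc
    · have : Continuous fun t : ℝ => ‖x - y‖ ^ 2 * ‖gradient w (x + t • (y - x))‖ ^ 2 := by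
        simp only [norm_gradient]
        exact continuous_const.mul ((hc.comp hline).norm.pow 2)
      exact this.integrableOn_Ioc
    · intro t
      simp only [norm_gradient, Pi.pow_apply]
      rw [← mul_pow, ← sq_abs (φ' t), ← Real.norm_eq_abs, mul_comm, norm_sub_rev]
      exact pow_le_pow_left₀ (norm_nonneg _) (ContinuousLinearMap.le_opNorm _ _) 2
  rw [integral_const_mul] at h3
  rw [h1] at h2
  calc (w x - w y) ^ 2 = (w y - w x) ^ 2 := by ring
    _ ≤ _ := h2.trans h3

theorem lintegral_comp_add_smul (g : Rn n → ENNReal) (hg : Measurable g) (c : Rn n) {t : ℝ}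
    (ht : 1 / 2 ≤ t) : ∫⁻ y, g (c + t • y) ≤ ENNReal.ofReal (2 ^ n) * ∫⁻ y, g y := by
  have ht0 : 0 < t := by linarith
  have h1 : ∫⁻ y, g (c + t • y) = ∫⁻ z, g (c + z) ∂(Measure.map (t • ·) volume) := by
    exact (lintegral_map (hg.comp (measurable_const_add c)) (measurable_const_smul t)).symm
  rw [h1, Measure.map_addHaar_smul volume ht0.ne', lintegral_smul_measure,
    lintegral_add_left_eq_self, finrank_euclideanSpace_fin, smul_eq_mul]
  gcongr
  rw [abs_of_pos (by positivity), ← inv_pow]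
  gcongr
  rw [inv_le_comm₀ ht0 two_pos]
  simpa using ht

/-- The point of the segment is (1 - t)x + ty, and one of the two coefficients is at least 1/2.
Integrating first in the corresponding variable costs a Jacobian of at most 2^n, uniformly in t. -/
theorem lintegral_segment_le (g : Rn n → ENNReal) (hg : Measurable g) {Z : Set (Rn n)}
    (hZ : Z ⊆ Metric.ball 0 1) {t : ℝ} :
    ∫⁻ x in Metric.ball 0 1, ∫⁻ y in Z, g (x + t • (y - x)) ≤
      volume (Metric.ball (0 : Rn n) 1) * (ENNReal.ofReal (2 ^ n) * ∫⁻ z, g z) := by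
  have hm : Measurable fun p : Rn n × Rn n => g (p.1 + t • (p.2 - p.1)) := by
    refine hg.comp ?_
    fun_prop
  rcases le_total (1 / 2) t with ht | ht
  · calc ∫⁻ x in Metric.ball 0 1, ∫⁻ y in Z, g (x + t • (y - x))
        ≤ ∫⁻ x in Metric.ball (0 : Rn n) 1, ENNReal.ofReal (2 ^ n) * ∫⁻ z, g z := by
          refine lintegral_mono fun x => ?_
          refine (setLIntegral_le_lintegral _ _).trans ?_
          have h (y : Rn n) : x + t • (y - x) = (x - t • x) + t • y := by rw [smul_sub]; abel
          simp only [h]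
          exact lintegral_comp_add_smul g hg _ ht
      _ = _ := by rw [setLIntegral_const, mul_comm]
  · calc ∫⁻ x in Metric.ball 0 1, ∫⁻ y in Z, g (x + t • (y - x))
        = ∫⁻ y in Z, ∫⁻ x in Metric.ball 0 1, g (x + t • (y - x)) :=
          lintegral_lintegral_swap hm.aemeasurable
      _ ≤ ∫⁻ y in Z, ENNReal.ofReal (2 ^ n) * ∫⁻ z, g z := by
          refine lintegral_mono fun y => ?_
          refine (setLIntegral_le_lintegral _ _).trans ?_
          have h (x : Rn n) : x + t • (y - x) = t • y + (1 - t) • x := by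
            rw [smul_sub, sub_smul, one_smul]; abel
          simp only [h]
          exact lintegral_comp_add_smul g hg _ (by linarith)
      _ ≤ _ := by
          rw [setLIntegral_const, mul_comm]
          gcongr

theorem integrable_of_bound_of_continuous_prod {f : Rn n × Rn n → ℝ} {μ : Measure (Rn n × Rn n)}
    [IsFiniteMeasure μ] (hf : Continuous f) {C : ℝ} (hC : ∀ p, |f p| ≤ C) : Integrable f μ :=
  Integrable.of_bound hf.aestronglyMeasurable C (Eventually.of_forall hC)

theorem weighted_poincare_of_contDiff (w : Rn n → ℝ) (hw : ContDiff ℝ 1 w) {K : NNReal}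
    (hK : LipschitzWith K w) {M : ℝ} (hM : ∀ x, |w x| ≤ M) {Z : Set (Rn n)}
    (hZm : MeasurableSet Z) (hZ : Z ⊆ Metric.ball 0 (1 / 2)) :
    ∫ p, (w p.1 - w p.2) ^ 2 * cone p.1 ^ 4 ∂((ballMeasure n).prod (volume.restrict Z)) ≤
      64 * (volume (Metric.ball (0 : Rn n) 1)).toReal * 2 ^ n *
        ∫ x, ‖gradient w x‖ ^ 2 * cone x ^ 4 ∂(ballMeasure n) := by
  have hM0 : 0 ≤ M := (abs_nonneg _).trans (hM 0)
  have hcone : Continuous (cone : Rn n → ℝ) := lipschitzWith_cone.continuous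
  have hwc := hw.continuous
  have hgc : Continuous fun x => ‖gradient w x‖ ^ 2 * cone x ^ 4 := by
    simp only [norm_gradient]
    exact ((hw.continuous_fderiv one_ne_zero).norm.pow 2).mul (hcone.pow 4)
  set G : Rn n → ℝ := fun x => ‖gradient w x‖ ^ 2 * cone x ^ 4 with hG
  have hG0 (x : Rn n) : 0 ≤ G x := by have := cone_nonneg x; simp only [hG]; positivity
  have hGz (x : Rn n) (hx : 1 ≤ ‖x‖) : G x = 0 := by simp [hG, cone_eq_zero hx]
  have hZf : IsFiniteMeasure (volume.restrict Z) :=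
    ⟨by rw [Measure.restrict_apply_univ]; exact (measure_mono hZ).trans_lt measure_ball_lt_top⟩
  have hGi : Integrable G (ballMeasure n) := by
    refine integrable_ballMeasure_of_bound hgc.aestronglyMeasurable (C := K ^ 2) fun x => ?_
    rw [abs_of_nonneg (hG0 x)]
    have h1 := norm_gradient_le hK x
    calc ‖gradient w x‖ ^ 2 * cone x ^ 4 ≤ K ^ 2 * 1 ^ 4 := by
          have := cone_nonneg x
          have := cone_le_one x
          gcongr
      _ = _ := by ring
  -- 64 = 4 · 2⁴: the squared diameter of the unit ball times the loss from moving the fourth power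
  -- of the weight along the segment.
  have hpt (x y : Rn n) (hx : ‖x‖ ≤ 1) (hy : ‖y‖ ≤ 1 / 2) :
      (w x - w y) ^ 2 * cone x ^ 4 ≤ 64 * ∫ t in Set.Ioc (0 : ℝ) 1, G (x + t • (y - x)) := by
    have hline : Continuous fun t : ℝ => x + t • (y - x) := by fun_prop
    have h1 := sq_sub_le_integral_segment hw x y
    have h2 : ‖x - y‖ ^ 2 ≤ 4 := by
      have : ‖x - y‖ ≤ 2 := (norm_sub_le x y).trans (by linarith)
      nlinarith [norm_nonneg (x - y)]
    have hc0 := cone_nonneg x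
    have hgl : Continuous fun t : ℝ => ‖gradient w (x + t • (y - x))‖ ^ 2 := by
      simp only [norm_gradient]
      exact (((hw.continuous_fderiv one_ne_zero).comp hline).norm.pow 2)
    have h3 : 0 ≤ ∫ t in Set.Ioc (0 : ℝ) 1, ‖gradient w (x + t • (y - x))‖ ^ 2 :=
      integral_nonneg fun t => by positivity
    calc (w x - w y) ^ 2 * cone x ^ 4
        ≤ (4 * ∫ t in Set.Ioc (0 : ℝ) 1, ‖gradient w (x + t • (y - x))‖ ^ 2) * cone x ^ 4 := by
          gcongr
          exact h1.trans (mul_le_mul_of_nonneg_right h2 h3)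
      _ = ∫ t in Set.Ioc (0 : ℝ) 1, 4 * cone x ^ 4 * ‖gradient w (x + t • (y - x))‖ ^ 2 := by
          rw [integral_const_mul]; ring
      _ ≤ ∫ t in Set.Ioc (0 : ℝ) 1, 64 * G (x + t • (y - x)) := by
          refine setIntegral_mono_on (continuous_const.mul hgl).integrableOn_Ioc
            (continuous_const.mul (hgc.comp hline)).integrableOn_Ioc measurableSet_Ioc
            fun t ht => ?_
          have h4 := cone_le_two_mul hx hy ht.1.le ht.2
          have h5 : cone x ^ 4 ≤ (2 * cone (x + t • (y - x))) ^ 4 := pow_le_pow_left₀ hc0 h4 4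
          have h6 : 0 ≤ ‖gradient w (x + t • (y - x))‖ ^ 2 := by positivity
          simp only [hG]
          nlinarith
      _ = _ := integral_const_mul _ _
  have hgm : Measurable fun x => ENNReal.ofReal (G x) := hgc.measurable.ennreal_ofReal
  have hV : volume (Metric.ball (0 : Rn n) 1) ≠ ⊤ := measure_ball_lt_top.ne
  have hR : ∫⁻ z, ENNReal.ofReal (G z) = ENNReal.ofReal (∫ x, G x ∂(ballMeasure n)) := by
    rw [ofReal_integral_eq_lintegral_ofReal hGi (Eventually.of_forall hG0)]
    refine (setLIntegral_eq_of_support_subset fun x hx => ?_).symm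
    by_contra h
    apply hx
    simp only [Metric.mem_ball, dist_zero_right, not_lt] at h
    simp [hGz x h]
  have hLm : Measurable fun p : Rn n × Rn n => ENNReal.ofReal ((w p.1 - w p.2) ^ 2 * cone p.1 ^ 4) :=
    Measurable.ennreal_ofReal (Continuous.measurable (by fun_prop))
  have hmain : ENNReal.ofReal (∫ p, (w p.1 - w p.2) ^ 2 * cone p.1 ^ 4
      ∂((ballMeasure n).prod (volume.restrict Z))) ≤ ENNReal.ofReal (64 *
        (volume (Metric.ball (0 : Rn n) 1)).toReal * 2 ^ n * ∫ x, G x ∂(ballMeasure n)) := by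
    rw [ofReal_integral_eq_lintegral_ofReal, lintegral_prod _ hLm.aemeasurable]
    · calc ∫⁻ x in Metric.ball 0 1, ∫⁻ y in Z, ENNReal.ofReal ((w x - w y) ^ 2 * cone x ^ 4)
          ≤ ∫⁻ x in Metric.ball 0 1, ∫⁻ y in Z, ∫⁻ t in Set.Ioc (0 : ℝ) 1,
              64 * ENNReal.ofReal (G (x + t • (y - x))) := by
            refine setLIntegral_mono' Metric.isOpen_ball.measurableSet fun x hx => ?_
            rw [mem_ball_zero_iff] at hx
            refine setLIntegral_mono' hZm fun y hy => ?_
            have hy' := mem_ball_zero_iff.1 (hZ hy)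
            have hline : Continuous fun t : ℝ => x + t • (y - x) := by fun_prop
            have h64 : (64 : ENNReal) = ENNReal.ofReal 64 := by simp
            have hgl : Measurable fun t : ℝ => ENNReal.ofReal (G (x + t • (y - x))) :=
              hgm.comp hline.measurable
            have hgi : IntegrableOn (fun t : ℝ => G (x + t • (y - x))) (Set.Ioc 0 1) :=
              (hgc.comp hline).integrableOn_Ioc
            rw [lintegral_const_mul _ hgl, ← ofReal_integral_eq_lintegral_ofReal hgi
                (Eventually.of_forall fun t => hG0 _), h64, ← ENNReal.ofReal_mul (by norm_num)]
            exact ENNReal.ofReal_le_ofReal (hpt x y hx.le hy'.le)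
        _ = ∫⁻ t in Set.Ioc (0 : ℝ) 1, ∫⁻ x in Metric.ball 0 1, ∫⁻ y in Z,
              64 * ENNReal.ofReal (G (x + t • (y - x))) := by
            have hm : Measurable fun p : (Rn n × ℝ) × Rn n =>
                64 * ENNReal.ofReal (G (p.1.1 + p.1.2 • (p.2 - p.1.1))) :=
              (hgm.comp (by fun_prop)).const_mul 64
            refine (lintegral_congr fun x => ?_).trans (lintegral_lintegral_swap
              (f := fun x t => ∫⁻ y in Z, 64 * ENNReal.ofReal (G (x + t • (y - x))))
              hm.lintegral_prod_right'.aemeasurable)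
            refine lintegral_lintegral_swap (Measurable.aemeasurable ?_)
            exact (hgm.comp (by fun_prop)).const_mul 64
        _ ≤ ∫⁻ t in Set.Ioc (0 : ℝ) 1, 64 * (volume (Metric.ball (0 : Rn n) 1) *
              (ENNReal.ofReal (2 ^ n) * ∫⁻ z, ENNReal.ofReal (G z))) := by
            refine lintegral_mono fun t => ?_
            have h (x : Rn n) : Measurable fun y => ENNReal.ofReal (G (x + t • (y - x))) :=
              hgm.comp (by fun_prop)
            simp only [lintegral_const_mul _ (h _)]
            rw [lintegral_const_mul']
            · gcongr
              exact lintegral_segment_le _ hgm (hZ.trans (Metric.ball_subset_ball (by norm_num)))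
            · simp
        _ = _ := by
            have h64 : (64 : ENNReal) = ENNReal.ofReal 64 := by simp
            rw [setLIntegral_const, hR, ENNReal.ofReal_mul (by positivity),
              ENNReal.ofReal_mul (by positivity), ENNReal.ofReal_mul (by positivity),
              ENNReal.ofReal_toReal hV, h64]
            simp only [Real.volume_Ioc, sub_zero, ENNReal.ofReal_one, mul_one, mul_assoc]
    · refine integrable_of_bound_of_continuous_prod (by fun_prop) (C := (2 * M) ^ 2) fun p => ?_
      have h0 := cone_nonneg p.1
      have h1 : cone p.1 ^ 4 ≤ 1 := pow_le_one₀ h0 (cone_le_one _)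
      have h2 : |w p.1 - w p.2| ≤ 2 * M := (abs_sub _ _).trans (by linarith [hM p.1, hM p.2])
      rw [abs_of_nonneg (by positivity), ← sq_abs]
      calc |w p.1 - w p.2| ^ 2 * cone p.1 ^ 4 ≤ (2 * M) ^ 2 * 1 := by gcongr
        _ = _ := mul_one _
    · exact Eventually.of_forall fun p => by have := cone_nonneg p.1; positivity
  refine (ENNReal.ofReal_le_ofReal_iff ?_).1 hmain
  have : 0 ≤ ∫ x, G x ∂(ballMeasure n) := integral_nonneg hG0
  positivity

theorem weighted_poincare_of_lipschitz (w : Rn n → ℝ) {K : NNReal}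
    (hK : LipschitzWith K w) {M : ℝ} (hM : ∀ x, |w x| ≤ M) {Z : Set (Rn n)}
    (hZm : MeasurableSet Z) (hZ : Z ⊆ Metric.ball 0 (1 / 2)) :
    ∫ p, (w p.1 - w p.2) ^ 2 * cone p.1 ^ 4 ∂((ballMeasure n).prod (volume.restrict Z)) ≤
      64 * (volume (Metric.ball (0 : Rn n) 1)).toReal * 2 ^ n *
        ∫ x, ‖gradient w x‖ ^ 2 * cone x ^ 4 ∂(ballMeasure n) := by
  have hwc := hK.continuous
  have hcone : Continuous (cone : Rn n → ℝ) := lipschitzWith_cone.continuous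
  have hc4 (x : Rn n) : 0 ≤ cone x ^ 4 ∧ cone x ^ 4 ≤ 1 :=
    ⟨pow_nonneg (cone_nonneg x) 4, pow_le_one₀ (cone_nonneg x) (cone_le_one _)⟩
  have hZf : IsFiniteMeasure (volume.restrict Z) :=
    ⟨by rw [Measure.restrict_apply_univ]; exact (measure_mono hZ).trans_lt measure_ball_lt_top⟩
  refine le_of_tendsto_of_tendsto'
    (f := fun k => ∫ p, (mollify w k p.1 - mollify w k p.2) ^ 2 * cone p.1 ^ 4
      ∂((ballMeasure n).prod (volume.restrict Z)))
    (g := fun k => 64 * (volume (Metric.ball (0 : Rn n) 1)).toReal * 2 ^ n *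
        ∫ x, ‖gradient (mollify w k) x‖ ^ 2 * cone x ^ 4 ∂(ballMeasure n)) (b := atTop)
    ?_ (Tendsto.const_mul _ ?_) fun k => ?_
  · refine tendsto_integral_of_dominated_convergence (fun _ => (2 * M) ^ 2) (fun k => ?_)
      (integrable_const _) (fun k => Eventually.of_forall fun p => ?_)
      (Eventually.of_forall fun p => ?_)
    · have := (contDiff_mollify hwc k).continuous
      exact Continuous.aestronglyMeasurable (by fun_prop)
    · have h2 : |mollify w k p.1 - mollify w k p.2| ≤ 2 * M := (abs_sub _ _).trans
        (by linarith [abs_mollify_le hwc hM k p.1, abs_mollify_le hwc hM k p.2])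
      obtain ⟨h0, h1⟩ := hc4 p.1
      rw [Real.norm_of_nonneg (by positivity), ← sq_abs]
      calc |mollify w k p.1 - mollify w k p.2| ^ 2 * cone p.1 ^ 4 ≤ (2 * M) ^ 2 * 1 := by gcongr
        _ = _ := mul_one _
    · exact (((tendsto_mollify hwc p.1).sub (tendsto_mollify hwc p.2)).pow 2).mul_const _
  · refine tendsto_integral_of_dominated_convergence (fun _ => (K : ℝ) ^ 2) (fun k => ?_)
      (integrable_const _) (fun k => Eventually.of_forall fun x => ?_) ?_
    · exact (((measurable_gradient _).norm.pow_const 2).mul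
        (hcone.pow 4).measurable).aestronglyMeasurable
    · obtain ⟨h0, h1⟩ := hc4 x
      rw [Real.norm_of_nonneg (by positivity)]
      have := norm_gradient_le (lipschitz_mollify hK k) x
      calc ‖gradient (mollify w k) x‖ ^ 2 * cone x ^ 4 ≤ (K : ℝ) ^ 2 * 1 := by gcongr
        _ = _ := mul_one _
    · filter_upwards [ae_restrict_of_ae (ae_tendsto_gradient_mollify hK)] with x hx
      exact (hx.norm.pow 2).mul_const _
  · exact weighted_poincare_of_contDiff _ ((contDiff_mollify hwc k).of_le (by exact_mod_cast le_top))
      (lipschitz_mollify hK k) (abs_mollify_le hwc hM k) hZm hZ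

/-- Weighted Poincaré inequality for functions that are controlled on a set `Z`. -/
theorem weighted_poincare (w : Rn n → ℝ) {K : NNReal}
    (hK : LipschitzWith K w) {M : ℝ} (hM : ∀ x, |w x| ≤ M) {Z : Set (Rn n)}
    (hZm : MeasurableSet Z) (hZ : Z ⊆ Metric.ball 0 (1 / 2)) {L : ℝ} (hL : ∀ x ∈ Z, |w x| ≤ L) :
    (volume Z).toReal * ∫ x, w x ^ 2 * cone x ^ 4 ∂(ballMeasure n) ≤
      128 * (volume (Metric.ball (0 : Rn n) 1)).toReal * 2 ^ n *
        ∫ x, ‖gradient w x‖ ^ 2 * cone x ^ 4 ∂(ballMeasure n) +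
      2 * L ^ 2 * (volume (Metric.ball (0 : Rn n) 1)).toReal ^ 2 := by
  have hwc := hK.continuous
  have hM0 : 0 ≤ M := (abs_nonneg _).trans (hM 0)
  have hcone : Continuous (cone : Rn n → ℝ) := lipschitzWith_cone.continuous
  have hc4 (x : Rn n) : 0 ≤ cone x ^ 4 ∧ cone x ^ 4 ≤ 1 :=
    ⟨pow_nonneg (cone_nonneg x) 4, pow_le_one₀ (cone_nonneg x) (cone_le_one _)⟩
  have hZB : volume Z ≤ volume (Metric.ball (0 : Rn n) 1) :=
    measure_mono (hZ.trans (Metric.ball_subset_ball (by norm_num)))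
  have hZf : IsFiniteMeasure (volume.restrict Z) :=
    ⟨by rw [Measure.restrict_apply_univ]; exact hZB.trans_lt measure_ball_lt_top⟩
  set π := (ballMeasure n).prod (volume.restrict Z) with hπ
  have h1 := weighted_poincare_of_lipschitz w hK hM hZm hZ
  have h2 : ∫ p, w p.1 ^ 2 * cone p.1 ^ 4 ∂π =
      (volume Z).toReal * ∫ x, w x ^ 2 * cone x ^ 4 ∂(ballMeasure n) := by
    have := integral_prod_mul (μ := ballMeasure n) (ν := volume.restrict Z)
      (fun x => w x ^ 2 * cone x ^ 4) (fun _ => (1 : ℝ))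
    simp only [mul_one] at this
    rw [hπ, this, mul_comm]
    simp [Measure.real]
  have hi1 : Integrable (fun p : Rn n × Rn n => w p.1 ^ 2 * cone p.1 ^ 4) π := by
    refine integrable_of_bound_of_continuous_prod (by fun_prop) (C := M ^ 2) fun p => ?_
    obtain ⟨h0, h1⟩ := hc4 p.1
    rw [abs_of_nonneg (by positivity), ← sq_abs]
    calc |w p.1| ^ 2 * cone p.1 ^ 4 ≤ M ^ 2 * 1 := by gcongr; exact hM _
      _ = _ := mul_one _
  have hi2 : Integrable (fun p : Rn n × Rn n => (w p.1 - w p.2) ^ 2 * cone p.1 ^ 4) π := by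
    refine integrable_of_bound_of_continuous_prod (by fun_prop) (C := (2 * M) ^ 2) fun p => ?_
    obtain ⟨h0, h1⟩ := hc4 p.1
    have h2 : |w p.1 - w p.2| ≤ 2 * M := (abs_sub _ _).trans (by linarith [hM p.1, hM p.2])
    rw [abs_of_nonneg (by positivity), ← sq_abs]
    calc |w p.1 - w p.2| ^ 2 * cone p.1 ^ 4 ≤ (2 * M) ^ 2 * 1 := by gcongr
      _ = _ := mul_one _
  have hae : ∀ᵐ p ∂π, p.2 ∈ Z := by
    have : ∀ᵐ y ∂(volume.restrict Z), y ∈ Z := ae_restrict_mem hZm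
    exact Measure.quasiMeasurePreserving_snd.ae this
  -- The values of `w` on `Z` serve as reference instead of a mean value: w(x)² ≤ 2(w(x) - w(y))² +
  -- 2w(y)², averaged over y ∈ Z.
  have h3 : ∫ p, w p.1 ^ 2 * cone p.1 ^ 4 ∂π ≤
      ∫ p, (2 * ((w p.1 - w p.2) ^ 2 * cone p.1 ^ 4) + 2 * L ^ 2) ∂π := by
    refine integral_mono_ae hi1 ((hi2.const_mul 2).add (integrable_const _)) ?_
    filter_upwards [hae] with p hp
    obtain ⟨h0, h1⟩ := hc4 p.1
    have h4 : w p.2 ^ 2 ≤ L ^ 2 := by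
      rw [← sq_abs]; exact pow_le_pow_left₀ (abs_nonneg _) (hL _ hp) 2
    have h5 : w p.1 ^ 2 ≤ 2 * (w p.1 - w p.2) ^ 2 + 2 * w p.2 ^ 2 := by
      nlinarith [sq_nonneg (w p.1 - 2 * w p.2)]
    calc w p.1 ^ 2 * cone p.1 ^ 4
        ≤ (2 * (w p.1 - w p.2) ^ 2 + 2 * L ^ 2) * cone p.1 ^ 4 := by gcongr; linarith
      _ = 2 * ((w p.1 - w p.2) ^ 2 * cone p.1 ^ 4) + 2 * L ^ 2 * cone p.1 ^ 4 := by ring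
      _ ≤ _ := by nlinarith [sq_nonneg L]
  rw [integral_add (hi2.const_mul 2) (integrable_const _), integral_const_mul, integral_const,
    h2] at h3
  have h6 : π.real Set.univ ≤ (volume (Metric.ball (0 : Rn n) 1)).toReal ^ 2 := by
    rw [hπ, Measure.real, ← Set.univ_prod_univ, Measure.prod_prod, ENNReal.toReal_mul,
      Measure.restrict_apply_univ, Measure.restrict_apply_univ, sq]
    gcongr
    exact measure_ball_lt_top.ne
  rw [smul_eq_mul] at h3
  nlinarith [sq_nonneg L]

end Poincare

/-! ### Truncations -/

section PosPart

theorem hasDerivAt_posPart_sq (k t : ℝ) :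
    HasDerivAt (fun s : ℝ => max (s - k) 0 ^ 2) (2 * max (t - k) 0) t := by
  rcases lt_trichotomy t k with h | h | h
  · rw [max_eq_right (by linarith), mul_zero]
    refine (hasDerivAt_const t (0 : ℝ)).congr_of_eventuallyEq ?_
    filter_upwards [Iio_mem_nhds h] with s hs
    rw [max_eq_right (by linarith [Set.mem_Iio.1 hs]), zero_pow two_ne_zero]
  · subst h
    rw [sub_self, max_self, mul_zero, hasDerivAt_iff_isLittleO]
    simp only [sub_self, max_self, smul_zero, sub_zero, ne_eq, two_ne_zero, not_false_eq_true,
      zero_pow]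
    have h1 : (fun s : ℝ => max (s - t) 0 ^ 2) =O[𝓝 t] fun s => (s - t) ^ 2 := by
      refine Asymptotics.IsBigO.of_bound 1 (Eventually.of_forall fun s => ?_)
      rw [one_mul, norm_pow, norm_pow]
      refine pow_le_pow_left₀ (norm_nonneg _) ?_ _
      rw [Real.norm_of_nonneg (le_max_right _ _)]
      exact max_le (le_abs_self _) (abs_nonneg _)
    refine h1.trans_isLittleO ?_
    have h2 : (fun x : ℝ => x ^ 2) =o[𝓝 0] fun x => x := by
      simpa using Asymptotics.isLittleO_pow_pow (𝕜 := ℝ) (m := 1) (n := 2) (by omega)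
    have h3 : Tendsto (fun s : ℝ => s - t) (𝓝 t) (𝓝 0) := by
      have : Continuous fun s : ℝ => s - t := by fun_prop
      simpa using this.tendsto t
    exact h2.comp_tendsto h3
  · rw [max_eq_left (by linarith)]
    have h1 : HasDerivAt (fun s : ℝ => (s - k) ^ 2) (2 * (t - k)) t := by
      simpa using ((hasDerivAt_id t).sub_const k).fun_pow 2
    refine h1.congr_of_eventuallyEq ?_
    filter_upwards [Ioi_mem_nhds h] with s hs
    rw [max_eq_left (by linarith [Set.mem_Ioi.1 hs])]

theorem lipschitz_posPart {α : Type*} [PseudoMetricSpace α] {w : α → ℝ} {K : NNReal}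
    (hK : LipschitzWith K w) (k : ℝ) : LipschitzWith K fun x => max (w x - k) 0 := by
  refine LipschitzWith.max_const (LipschitzWith.of_dist_le_mul fun x y => ?_) 0
  rw [dist_sub_right]
  exact hK.dist_le_mul x y

/-- On {w ≤ k} the truncation attains its minimum 0, so its gradient vanishes there wherever it
exists. No separate treatment of the level set {w = k} is needed. -/
theorem ae_hasGradientAt_posPart {n : ℕ} {w : Rn n → ℝ} {K : NNReal} (hK : LipschitzWith K w)
    (k : ℝ) : ∀ᵐ x ∂(volume : Measure (Rn n)),
      HasGradientAt (fun y => max (w y - k) 0) ((if k < w x then (1 : ℝ) else 0) • gradient w x)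
        x := by
  filter_upwards [ae_hasGradientAt hK, ae_hasGradientAt (lipschitz_posPart hK k)] with x hx hx'
  split_ifs with h
  · have h1 : HasGradientAt (fun y => w y - k) ((1 : ℝ) • gradient w x) x :=
      hasGradientAt_comp (φ := fun t => t - k) ((hasDerivAt_id _).sub_const k) hx
    have h2 : ∀ᶠ y in 𝓝 x, k < w y := hK.continuous.continuousAt.eventually_const_lt h
    rw [hasGradientAt_iff_hasFDerivAt] at h1 ⊢
    refine h1.congr_of_eventuallyEq ?_
    filter_upwards [h2] with y hy
    exact max_eq_left (by linarith)
  · have h1 : gradient (fun y => max (w y - k) 0) x = 0 :=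
      gradient_eq_zero_of_nonneg (fun y => le_max_right _ _) (max_eq_right (by linarith))
    rwa [h1, ← zero_smul ℝ (gradient w x)] at hx'

end PosPart

/-! ### The equation in the unit ball -/

/-- Coefficients of the equation in the unit ball: `a` is elliptic with constant `ν` and bounded
by `Λ`, the drift `b` is integrable and its divergence is nonpositive. -/
structure BallCoeff {n : ℕ} (a : Rn n → Matrix (Fin n) (Fin n) ℝ) (b : Rn n → Rn n)
    (ν Λ : ℝ) : Prop where
  nu_pos : 0 < ν
  lam_nonneg : 0 ≤ Λ
  elliptic : ∀ᵐ x ∂(volume : Measure (Rn n)), ∀ p : Rn n, ν * ‖p‖ ^ 2 ≤ aform (a x) p p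
  bounded : ∀ᵐ x ∂(volume : Measure (Rn n)), ∀ p q : Rn n, |aform (a x) p q| ≤ Λ * ‖p‖ * ‖q‖
  aestronglyMeasurable : ∀ i j, AEStronglyMeasurable (fun x => a x i j) volume
  integrable : Integrable b (ballMeasure n)
  div_nonpos : ∀ φ : Rn n → ℝ, IsTest φ → (∀ x, 1 ≤ ‖x‖ → φ x = 0) →
    0 ≤ ∫ x, inner ℝ (b x) (gradient φ x) ∂(ballMeasure n)

/-- Supersolutions in the unit ball. -/
def BallSupersolution {n : ℕ} (a : Rn n → Matrix (Fin n) (Fin n) ℝ) (b : Rn n → Rn n)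
    (v : Rn n → ℝ) : Prop :=
  ∀ η : Rn n → ℝ, IsTest η → (∀ x, 1 ≤ ‖x‖ → η x = 0) →
    0 ≤ ∫ x, (aform (a x) (gradient v x) (gradient η x) + inner ℝ (b x) (gradient v x) * η x)
      ∂(ballMeasure n)

/-- The inequality satisfied by `w = -log v` for a positive supersolution `v`. -/
def BallLogSubsolution {n : ℕ} (a : Rn n → Matrix (Fin n) (Fin n) ℝ) (b : Rn n → Rn n)
    (w : Rn n → ℝ) : Prop :=
  ∀ θ : Rn n → ℝ, IsTest θ → (∀ x, 1 ≤ ‖x‖ → θ x = 0) →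
    ∫ x, (aform (a x) (gradient w x) (gradient w x) * θ x +
      aform (a x) (gradient w x) (gradient θ x) + inner ℝ (b x) (gradient w x) * θ x)
      ∂(ballMeasure n) ≤ 0

/-! ### Energy estimates for w = -log v -/

section Energy

variable {n : ℕ} {a : Rn n → Matrix (Fin n) (Fin n) ℝ} {b : Rn n → Rn n} {ν Λ : ℝ}

theorem hasCompactSupport_of_eq_zero {f : Rn n → ℝ} (hf : ∀ x, 1 ≤ ‖x‖ → f x = 0) :
    HasCompactSupport f :=
  HasCompactSupport.of_support_subset_isCompact (isCompact_closedBall (0 : Rn n) 1) fun x hx => by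
    by_contra h
    rw [mem_closedBall_zero_iff, not_le] at h
    exact hx (hf x h.le)

theorem isTest_of_eq_zero {f : Rn n → ℝ} (hL : ∃ L, LipschitzWith L f) (hnn : ∀ x, 0 ≤ f x)
    (hf : ∀ x, 1 ≤ ‖x‖ → f x = 0) : IsTest f :=
  ⟨hL, hasCompactSupport_of_eq_zero hf, hnn⟩

theorem IsTest.exists_bound {θ : Rn n → ℝ} (h : IsTest θ) : ∃ C, ∀ x, |θ x| ≤ C := by
  obtain ⟨⟨K, hK⟩, hs, -⟩ := h
  exact hs.exists_bound_of_continuous hK.continuous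

/-- Test the supersolution with θ/v. Differentiating 1/v produces the quadratic term in ∇w. The
lower bound ε > 0 is used only to make θ/v Lipschitz and does not enter the conclusion. -/
theorem BallSupersolution.neg_log {v : Rn n → ℝ} (hv : BallSupersolution a b v) {K : NNReal}
    (hK : LipschitzWith K v) {ε : ℝ} (hε : 0 < ε) (hεv : ∀ x, ε ≤ v x) (hv1 : ∀ x, v x ≤ 1) :
    BallLogSubsolution a b fun x => -Real.log (v x) := by
  intro θ hθ hθ0
  obtain ⟨Kθ, hKθ⟩ := hθ.1
  obtain ⟨C, hC⟩ := hθ.exists_bound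
  have hpos (x : Rn n) : 0 < v x := hε.trans_le (hεv x)
  have hinv : ∃ L, LipschitzWith L fun x => (v x)⁻¹ := by
    refine exists_lipschitzWith_comp hK (s := ε) (t := 1) (φ := fun t => t⁻¹)
      (φ' := fun t => -(t ^ 2)⁻¹) (fun x => ⟨hεv x, hv1 x⟩) (fun y hy => ?_) ?_
    · exact hasDerivAt_inv (hε.trans_le hy.1).ne'
    · refine ((continuousOn_id.pow 2).inv₀ fun y hy => ?_).neg
      exact pow_ne_zero 2 (hε.trans_le hy.1).ne'
  obtain ⟨L, hL⟩ := hinv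
  have hinvb (x : Rn n) : |(v x)⁻¹| ≤ ε⁻¹ := by
    rw [abs_of_pos (inv_pos.2 (hpos x))]
    exact inv_anti₀ hε (hεv x)
  have htest : IsTest fun x => θ x * (v x)⁻¹ :=
    isTest_of_eq_zero (exists_lipschitzWith_mul hKθ hL hC hinvb)
      (fun x => mul_nonneg (hθ.2.2 x) (inv_pos.2 (hpos x)).le) fun x hx => by simp [hθ0 x hx]
  have h := hv _ htest fun x hx => by simp [hθ0 x hx]
  rw [← neg_nonneg, ← integral_neg]
  refine h.trans_eq (integral_congr_ae ?_)
  filter_upwards [ae_restrict_of_ae (ae_hasGradientAt hK),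
    ae_restrict_of_ae (ae_hasGradientAt hKθ)] with x hx hx'
  have hx0 := (hpos x).ne'
  have e1 : gradient (fun y => -Real.log (v y)) x = (-(v x)⁻¹) • gradient v x :=
    (hasGradientAt_comp (φ := fun t => -Real.log t) (Real.hasDerivAt_log hx0).neg hx).gradient
  have e2 : gradient (fun y => θ y * (v y)⁻¹) x =
      θ x • ((-(v x ^ 2)⁻¹) • gradient v x) + (v x)⁻¹ • gradient θ x :=
    (hasGradientAt_mul hx' (hasGradientAt_comp (φ := fun t => t⁻¹) (hasDerivAt_inv hx0) hx)).gradient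
  rw [e1, e2]
  simp only [aform_add_right, aform_smul_left, aform_smul_right, inner_smul_right]
  field_simp
  ring

theorem BallCoeff.integrable_inner (hc : BallCoeff a b ν Λ) {p : Rn n → Rn n} (hp : Measurable p)
    {C : ℝ} (hC : ∀ x, ‖p x‖ ≤ C) : Integrable (fun x => inner ℝ (b x) (p x)) (ballMeasure n) := by
  refine (hc.integrable.norm.mul_const C).mono'
    (hc.integrable.aestronglyMeasurable.inner hp.aestronglyMeasurable)
    (Eventually.of_forall fun x => ?_)
  exact (norm_inner_le_norm _ _).trans (mul_le_mul_of_nonneg_left (hC x) (norm_nonneg _))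

theorem BallCoeff.integrable_aform (hc : BallCoeff a b ν Λ) {p r : Rn n → Rn n}
    (hp : Measurable p) (hr : Measurable r) {C D : ℝ} (hC : ∀ x, ‖p x‖ ≤ C)
    (hD : ∀ x, ‖r x‖ ≤ D) : Integrable (fun x => aform (a x) (p x) (r x)) (ballMeasure n) := by
  have hm : AEStronglyMeasurable (fun x => aform (a x) (p x) (r x)) (ballMeasure n) := by
    simp only [aform]
    refine Finset.aestronglyMeasurable_fun_sum _ fun i _ =>
      Finset.aestronglyMeasurable_fun_sum _ fun j _ => ?_
    refine ((hc.aestronglyMeasurable i j).restrict.mul ?_).mul ?_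
    · exact ((EuclideanSpace.proj (𝕜 := ℝ) j).continuous.measurable.comp hp).aestronglyMeasurable
    · exact ((EuclideanSpace.proj (𝕜 := ℝ) i).continuous.measurable.comp hr).aestronglyMeasurable
  refine (integrable_const (Λ * C * D)).mono' hm ?_
  filter_upwards [ae_restrict_of_ae hc.bounded] with x hx
  refine (hx _ _).trans ?_
  have := hc.lam_nonneg
  have := (norm_nonneg _).trans (hC x)
  gcongr
  · exact hC x
  · exact hD x

theorem integrable_mul_of_bound {f g : Rn n → ℝ} {μ : Measure (Rn n)} (hf : Integrable f μ)
    (hg : Measurable g) {C : ℝ} (hC : ∀ x, |g x| ≤ C) : Integrable (fun x => f x * g x) μ := by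
  exact hf.mul_bdd hg.aestronglyMeasurable (Eventually.of_forall hC)

theorem BallCoeff.integrable_logForm (hc : BallCoeff a b ν Λ) {w θ : Rn n → ℝ} {K : NNReal}
    (hK : LipschitzWith K w) (hθ : IsTest θ) :
    Integrable (fun x => aform (a x) (gradient w x) (gradient w x) * θ x +
      aform (a x) (gradient w x) (gradient θ x) + inner ℝ (b x) (gradient w x) * θ x)
      (ballMeasure n) := by
  obtain ⟨Kθ, hKθ⟩ := hθ.1
  obtain ⟨C, hC⟩ := hθ.exists_bound
  have hθm := hKθ.continuous.measurable
  have hw := measurable_gradient w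
  have hwK := norm_gradient_le hK
  refine Integrable.add (Integrable.add ?_ ?_) ?_
  · exact integrable_mul_of_bound (hc.integrable_aform hw hw hwK hwK) hθm hC
  · exact hc.integrable_aform hw (measurable_gradient θ) hwK (norm_gradient_le hKθ)
  · exact integrable_mul_of_bound (hc.integrable_inner hw hwK) hθm hC

/-- The common frame of both energy estimates: `F` is the integrand of the inequality for `w`, `h`
the integrand of the divergence condition, and the estimate itself reduces to pointwise algebra. -/
theorem integral_le_integral_of_ae_le {α : Type*} [MeasurableSpace α] {μ : Measure α}
    {f g h F : α → ℝ} (hf : Integrable f μ) (hg : Integrable g μ) (hh : Integrable h μ)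
    (hF : Integrable F μ) (hle : ∀ᵐ x ∂μ, f x - g x + h x ≤ F x) (hh0 : 0 ≤ ∫ x, h x ∂μ)
    (hF0 : ∫ x, F x ∂μ ≤ 0) : ∫ x, f x ∂μ ≤ ∫ x, g x ∂μ := by
  have h1 : ∫ x, (f - g + h) x ∂μ ≤ ∫ x, F x ∂μ := integral_mono_ae ((hf.sub hg).add hh) hF hle
  rw [integral_add' (hf.sub hg) hh, integral_sub' hf hg] at h1
  linarith

theorem lipschitz_pow_of_le_one {ζ : Rn n → ℝ} {κ : NNReal} (hκ : LipschitzWith κ ζ)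
    (h0 : ∀ x, 0 ≤ ζ x) (h1 : ∀ x, ζ x ≤ 1) (m : ℕ) : ∃ L, LipschitzWith L fun x => ζ x ^ m :=
  exists_lipschitzWith_comp hκ (s := 0) (t := 1) (φ := fun t => t ^ m)
    (φ' := fun t => m * t ^ (m - 1)) (fun x => ⟨h0 x, h1 x⟩) (fun y _ => hasDerivAt_pow m y)
    (Continuous.continuousOn (by fun_prop))

/-- The logarithmic estimate. -/
theorem BallCoeff.log_estimate (hc : BallCoeff a b ν Λ) {w : Rn n → ℝ} {K : NNReal}
    (hK : LipschitzWith K w) {M : ℝ} (h0 : ∀ x, 0 ≤ w x) (hM : ∀ x, w x ≤ M)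
    (hw : BallLogSubsolution a b w) :
    ν / 2 * ∫ x, ‖gradient w x‖ ^ 2 * cone x ^ 4 ∂(ballMeasure n) ≤
      8 * Λ ^ 2 / ν * (volume (Metric.ball (0 : Rn n) 1)).toReal +
      4 * ∫ x, (w x * cone x ^ 3) * ‖b x‖ ∂(ballMeasure n) := by
  have hν := hc.nu_pos
  have hΛ := hc.lam_nonneg
  have hcl := lipschitzWith_cone (n := n)
  have hcone : Continuous (cone : Rn n → ℝ) := hcl.continuous
  obtain ⟨L4, hL4⟩ := lipschitz_pow_of_le_one hcl cone_nonneg cone_le_one 4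
  have hθ : IsTest fun x : Rn n => cone x ^ 4 :=
    isTest_of_eq_zero ⟨L4, hL4⟩ (fun x => pow_nonneg (cone_nonneg x) 4)
      fun x hx => by simp [cone_eq_zero hx]
  have hwM (x : Rn n) : |w x| ≤ M := by rw [abs_of_nonneg (h0 x)]; exact hM x
  have hc4 (m : ℕ) (x : Rn n) : |cone x ^ m| ≤ 1 := by
    rw [abs_of_nonneg (pow_nonneg (cone_nonneg x) m)]
    exact pow_le_one₀ (cone_nonneg x) (cone_le_one x)
  obtain ⟨Lφ, hLφ⟩ := exists_lipschitzWith_mul hK hL4 hwM (hc4 4)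
  -- With ζ the cone, ζ⁴ b·∇w = b·∇(wζ⁴) - 4wζ³ b·∇ζ. The first term has nonnegative integral and is
  -- dropped; the second contains no gradient of `w`.
  have hφ : IsTest fun x => w x * cone x ^ 4 :=
    isTest_of_eq_zero ⟨Lφ, hLφ⟩ (fun x => mul_nonneg (h0 x) (pow_nonneg (cone_nonneg x) 4))
      fun x hx => by simp [cone_eq_zero hx]
  have hE := hw _ hθ fun x hx => by simp [cone_eq_zero hx]
  have hD := hc.div_nonpos _ hφ fun x hx => by simp [cone_eq_zero hx]
  have i1 : Integrable (fun x => ‖gradient w x‖ ^ 2 * cone x ^ 4) (ballMeasure n) := by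
    refine integrable_ballMeasure_of_bound (C := K ^ 2 * 1) (((measurable_gradient
      _).norm.pow_const 2).mul (hcone.pow 4).measurable).aestronglyMeasurable fun x => ?_
    rw [abs_mul, abs_of_nonneg (sq_nonneg _)]
    exact mul_le_mul (pow_le_pow_left₀ (norm_nonneg _) (norm_gradient_le hK x) 2) (hc4 4 x)
      (abs_nonneg _) (by positivity)
  have i2 : Integrable (fun x => (w x * cone x ^ 3) * ‖b x‖) (ballMeasure n) := by
    simp only [mul_comm _ ‖b _‖]
    refine integrable_mul_of_bound hc.integrable.norm
      (hK.continuous.mul (hcone.pow 3)).measurable (C := M * 1) fun x => ?_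
    rw [abs_mul]
    exact mul_le_mul (hwM x) (hc4 3 x) (abs_nonneg _) ((abs_nonneg _).trans (hwM x))
  have i3 : Integrable (fun x => inner ℝ (b x) (gradient (fun y => w y * cone y ^ 4) x))
      (ballMeasure n) := hc.integrable_inner (measurable_gradient _) (norm_gradient_le hLφ)
  have hsum : ∫ x, ν / 2 * (‖gradient w x‖ ^ 2 * cone x ^ 4) ∂(ballMeasure n) ≤
      ∫ x, (8 * Λ ^ 2 / ν + 4 * ((w x * cone x ^ 3) * ‖b x‖)) ∂(ballMeasure n) := by
    refine integral_le_integral_of_ae_le (i1.const_mul _) ((integrable_const _).add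
      (i2.const_mul 4)) i3 (hc.integrable_logForm hK hθ) ?_ hD hE
    filter_upwards [ae_restrict_of_ae (ae_hasGradientAt hK),
      ae_restrict_of_ae (ae_hasGradientAt hcl), ae_restrict_of_ae hc.elliptic,
      ae_restrict_of_ae hc.bounded] with x hx hx' hel hbd
    have e1 := hasGradientAt_comp (φ := fun t => t ^ 4) (hasDerivAt_pow 4 (cone x)) hx'
    have e2 := hasGradientAt_mul hx e1
    rw [e1.gradient, e2.gradient]
    simp only [aform_smul_right, inner_add_right, inner_smul_right]
    have hζ0 := cone_nonneg x
    have hζ1 := cone_le_one x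
    have hζ' : ‖gradient cone x‖ ≤ 1 := by simpa using norm_gradient_le hcl x
    have a1 := hel (gradient w x)
    have a2 := hbd (gradient w x) (gradient cone x)
    have a3 := norm_inner_le_norm (𝕜 := ℝ) (b x) (gradient cone x)
    rw [Real.norm_eq_abs] at a3
    set G := ‖gradient w x‖
    set ζ := cone x
    set A := aform (a x) (gradient w x) (gradient cone x)
    set I := inner ℝ (b x) (gradient cone x)
    have hG : 0 ≤ G := norm_nonneg _
    have a4 : -A ≤ Λ * G := by
      have : Λ * G * ‖gradient cone x‖ ≤ Λ * G * 1 := by gcongr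
      linarith [neg_le_abs A]
    have a5 : I ≤ ‖b x‖ := by
      have : ‖b x‖ * ‖gradient cone x‖ ≤ ‖b x‖ * 1 := by gcongr
      linarith [le_abs_self I]
    -- Young's inequality by completing the square; half of the elliptic term is spent here.
    have a6 : 4 * ζ ^ 3 * (Λ * G) ≤ ν / 2 * (G ^ 2 * ζ ^ 4) + 8 * Λ ^ 2 / ν := by
      have h1 : 4 * ζ ^ 3 * (Λ * G) ≤ ν / 2 * (G ^ 2 * ζ ^ 4) + 8 * Λ ^ 2 / ν * ζ ^ 2 := by
        have h2 : ν / 2 * (G ^ 2 * ζ ^ 4) + 8 * Λ ^ 2 / ν * ζ ^ 2 - 4 * ζ ^ 3 * (Λ * G) =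
            ν / 2 * (G * ζ ^ 2 - 4 * Λ / ν * ζ) ^ 2 := by
          field_simp
          ring
        have h3 : 0 ≤ ν / 2 * (G * ζ ^ 2 - 4 * Λ / ν * ζ) ^ 2 := by positivity
        linarith
      have h4 : 8 * Λ ^ 2 / ν * ζ ^ 2 ≤ 8 * Λ ^ 2 / ν * 1 := by
        gcongr
        exact pow_le_one₀ hζ0 hζ1
      linarith
    have a7 : ν * G ^ 2 * ζ ^ 4 ≤ aform (a x) (gradient w x) (gradient w x) * ζ ^ 4 := by
      gcongr
    have a8 : -(4 * ζ ^ 3 * A) ≤ 4 * ζ ^ 3 * (Λ * G) := by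
      have := mul_le_mul_of_nonneg_left a4 (by positivity : 0 ≤ 4 * ζ ^ 3)
      linarith
    have a9 : w x * (4 * ζ ^ 3 * I) ≤ w x * (4 * ζ ^ 3 * ‖b x‖) := by
      have := h0 x
      gcongr
    push_cast
    norm_num
    linarith
  rw [integral_add (integrable_const _) (i2.const_mul 4), integral_const_mul, integral_const_mul,
    integral_const] at hsum
  simp only [smul_eq_mul, Measure.real, Measure.restrict_apply_univ] at hsum
  linarith

/-- Caccioppoli's inequality for the truncations of `w`. -/
theorem BallCoeff.caccioppoli (hc : BallCoeff a b ν Λ) {w : Rn n → ℝ} {K : NNReal}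
    (hK : LipschitzWith K w) {M : ℝ} (h0 : ∀ x, 0 ≤ w x) (hM : ∀ x, w x ≤ M)
    (hw : BallLogSubsolution a b w) (k : ℝ) {ζ : Rn n → ℝ} {κ : NNReal} (hκ : LipschitzWith κ ζ)
    (hκ1 : 1 ≤ κ) (hζ0 : ∀ x, 0 ≤ ζ x) (hζ1 : ∀ x, ζ x ≤ 1) {r : ℝ} (hr : r ≤ 1)
    (hζr : ∀ x, r ≤ ‖x‖ → ζ x = 0) :
    ν / 2 * ∫ x, ‖gradient (fun y => max (w y - k) 0 * ζ y) x‖ ^ 2 ∂(ballMeasure n) ≤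
      (ν + 4 * Λ ^ 2 / ν + 2) * κ ^ 2 *
        ∫ x, (Metric.ball (0 : Rn n) r).indicator (fun x => max (w x - k) 0 ^ 2) x * (1 + ‖b x‖)
          ∂(ballMeasure n) := by
  have hν := hc.nu_pos
  have hΛ := hc.lam_nonneg
  have hζz (x : Rn n) (hx : 1 ≤ ‖x‖) : ζ x = 0 := hζr x (hr.trans hx)
  have hκ1' : (1 : ℝ) ≤ κ := by exact_mod_cast hκ1
  have hζb (x : Rn n) : |ζ x| ≤ 1 := by rw [abs_of_nonneg (hζ0 x)]; exact hζ1 x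
  have hζ2b (x : Rn n) : |ζ x ^ 2| ≤ 1 := by
    rw [abs_of_nonneg (pow_nonneg (hζ0 x) 2)]
    exact pow_le_one₀ (hζ0 x) (hζ1 x)
  obtain ⟨L2, hL2⟩ := lipschitz_pow_of_le_one hκ hζ0 hζ1 2
  have hM0 : 0 ≤ M := (h0 0).trans (hM 0)
  have hy0 (x : Rn n) : 0 ≤ max (w x - k) 0 := le_max_right _ _
  have hyb (x : Rn n) : |max (w x - k) 0| ≤ M + |k| := by
    rw [abs_of_nonneg (hy0 x)]
    refine max_le ?_ (by positivity)
    linarith [hM x, neg_abs_le k]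
  have hy2b (x : Rn n) : |max (w x - k) 0 ^ 2| ≤ (M + |k|) ^ 2 := by
    rw [abs_pow]
    exact pow_le_pow_left₀ (abs_nonneg _) (hyb x) 2
  have hLy := lipschitz_posPart hK k
  obtain ⟨Ly2, hLy2⟩ : ∃ L, LipschitzWith L fun x => max (w x - k) 0 ^ 2 := by
    simp only [sq]
    exact exists_lipschitzWith_mul hLy hLy hyb hyb
  obtain ⟨Lf, hLf⟩ := exists_lipschitzWith_mul hLy hκ hyb hζb
  obtain ⟨Lθ, hLθ⟩ := exists_lipschitzWith_mul hLy hL2 hyb hζ2b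
  obtain ⟨Lφ, hLφ⟩ := exists_lipschitzWith_mul hLy2 hL2 hy2b hζ2b
  -- The factor 2 makes the drift term equal to ζ² b·∇((w - k)₊²), which matches the test function
  -- (w - k)₊²ζ² used below in the divergence condition.
  have hθ : IsTest fun x => 2 * (max (w x - k) 0 * ζ x ^ 2) := by
    refine isTest_of_eq_zero ?_ (fun x => by have := hy0 x; positivity)
      fun x hx => by simp [hζz x hx]
    exact exists_lipschitzWith_mul (LipschitzWith.const 2) hLθ (A := 2) (fun x => by simp)
      (B := (M + |k|) * 1) fun x => by
        rw [abs_mul]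
        exact mul_le_mul (hyb x) (hζ2b x) (abs_nonneg _) ((abs_nonneg _).trans (hyb x))
  have hφ : IsTest fun x => max (w x - k) 0 ^ 2 * ζ x ^ 2 :=
    isTest_of_eq_zero ⟨Lφ, hLφ⟩ (fun x => by have := hy0 x; positivity)
      fun x hx => by simp [hζz x hx]
  have hE := hw _ hθ fun x hx => by simp [hζz x hx]
  have hD := hc.div_nonpos _ hφ fun x hx => by simp [hζz x hx]
  have i1 : Integrable (fun x => ‖gradient (fun y => max (w y - k) 0 * ζ y) x‖ ^ 2)
      (ballMeasure n) := by
    refine integrable_ballMeasure_of_bound (C := Lf ^ 2)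
      ((measurable_gradient _).norm.pow_const 2).aestronglyMeasurable fun x => ?_
    rw [abs_of_nonneg (sq_nonneg _)]
    exact pow_le_pow_left₀ (norm_nonneg _) (norm_gradient_le hLf x) 2
  have i2 : Integrable (fun x => (Metric.ball (0 : Rn n) r).indicator
      (fun x => max (w x - k) 0 ^ 2) x * (1 + ‖b x‖)) (ballMeasure n) := by
    simp only [mul_comm _ (1 + ‖b _‖)]
    refine integrable_mul_of_bound ((integrable_const 1).add hc.integrable.norm)
      (hLy2.continuous.measurable.indicator Metric.isOpen_ball.measurableSet)
      (C := (M + |k|) ^ 2) fun x => ?_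
    by_cases hx : x ∈ Metric.ball (0 : Rn n) r
    · rw [Set.indicator_of_mem hx]; exact hy2b x
    · rw [Set.indicator_of_notMem hx, abs_zero]; positivity
  have i3 : Integrable (fun x => inner ℝ (b x) (gradient (fun y => max (w y - k) 0 ^ 2 * ζ y ^ 2) x))
      (ballMeasure n) := hc.integrable_inner (measurable_gradient _) (norm_gradient_le hLφ)
  set C : ℝ := (ν + 4 * Λ ^ 2 / ν + 2) * κ ^ 2 with hC
  have hsum : ∫ x, ν / 2 * ‖gradient (fun y => max (w y - k) 0 * ζ y) x‖ ^ 2 ∂(ballMeasure n) ≤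
      ∫ x, C * ((Metric.ball (0 : Rn n) r).indicator (fun x => max (w x - k) 0 ^ 2) x *
        (1 + ‖b x‖)) ∂(ballMeasure n) := by
    refine integral_le_integral_of_ae_le (i1.const_mul _) (i2.const_mul _) i3
      (hc.integrable_logForm hK hθ) ?_ hD hE
    filter_upwards [ae_restrict_of_ae (ae_hasGradientAt hK),
      ae_restrict_of_ae (ae_hasGradientAt_posPart hK k),
      ae_restrict_of_ae (ae_hasGradientAt hκ), ae_restrict_of_ae hc.elliptic,
      ae_restrict_of_ae hc.bounded] with x hx hxy hx' hel hbd
    have d2 := hasGradientAt_comp (hasDerivAt_posPart_sq k (w x)) hx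
    have dζ := hasGradientAt_comp (φ := fun t => t ^ 2) (hasDerivAt_pow 2 (ζ x)) hx'
    -- `c` is the indicator of {w > k}. Only c² = c, c ≥ 0 and (w - k)₊c = (w - k)₊ are used from
    -- here on.
    obtain ⟨c, hcdef⟩ : ∃ c : ℝ, c = if k < w x then 1 else 0 := ⟨_, rfl⟩
    rw [← hcdef] at hxy
    have hcc : c * c = c := by rw [hcdef]; split_ifs <;> simp
    have hc0 : 0 ≤ c := by rw [hcdef]; split_ifs <;> simp
    have hcY : max (w x - k) 0 * c = max (w x - k) 0 := by
      rw [hcdef]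
      split_ifs with h
      · rw [mul_one]
      · rw [max_eq_right (by linarith), zero_mul]
    set G := gradient w x
    set Z := gradient ζ x
    set Y := max (w x - k) 0 with hY
    have hY0 : 0 ≤ Y := hy0 x
    have e1 : gradient (fun y => max (w y - k) 0 * ζ y) x = (ζ x * c) • G + Y • Z := by
      refine (hasGradientAt_mul hxy hx').gradient.trans ?_
      module
    have e2 : gradient (fun y => 2 * (max (w y - k) 0 * ζ y ^ 2)) x =
        (2 * ζ x ^ 2 * c) • G + (4 * Y * ζ x) • Z := by
      refine (hasGradientAt_mul (hasGradientAt_const x (2 : ℝ))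
        (hasGradientAt_mul hxy dζ)).gradient.trans ?_
      push_cast
      module
    have e3 : gradient (fun y => max (w y - k) 0 ^ 2 * ζ y ^ 2) x =
        (2 * Y * ζ x ^ 2) • G + (2 * Y ^ 2 * ζ x) • Z := by
      refine (hasGradientAt_mul d2 dζ).gradient.trans ?_
      push_cast
      module
    rw [e1, e2, e3]
    simp only [aform_add_right, aform_smul_right, inner_add_right, inner_smul_right]
    by_cases hxr : x ∈ Metric.ball (0 : Rn n) r
    · rw [Set.indicator_of_mem hxr]
      have z0 := hζ0 x
      have z1 := hζ1 x
      have hZ : ‖Z‖ ≤ κ := norm_gradient_le hκ x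
      have a1 := hel G
      have a2 := hbd G Z
      have a3 := norm_inner_le_norm (𝕜 := ℝ) (b x) Z
      rw [Real.norm_eq_abs] at a3
      have hN : ‖(ζ x * c) • G + Y • Z‖ ^ 2 ≤
          2 * (ζ x ^ 2 * (c * ‖G‖ ^ 2)) + 2 * (Y ^ 2 * κ ^ 2) := by
        have h1 : ‖(ζ x * c) • G + Y • Z‖ ≤ ζ x * c * ‖G‖ + Y * κ := by
          refine (norm_add_le _ _).trans ?_
          rw [norm_smul, norm_smul, Real.norm_of_nonneg (by positivity),
            Real.norm_of_nonneg (by positivity)]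
          gcongr
        calc _ ≤ (ζ x * c * ‖G‖ + Y * κ) ^ 2 := pow_le_pow_left₀ (norm_nonneg _) h1 2
          _ ≤ 2 * (ζ x * c * ‖G‖) ^ 2 + 2 * (Y * κ) ^ 2 := by
            nlinarith [sq_nonneg (ζ x * c * ‖G‖ - Y * κ)]
          _ = 2 * (ζ x ^ 2 * (c * c * ‖G‖ ^ 2)) + 2 * (Y ^ 2 * κ ^ 2) := by ring
          _ = _ := by rw [hcc]
      set A := aform (a x) G Z
      set I := inner ℝ (b x) Z
      set g := ‖G‖
      set β := ‖b x‖
      have hg : 0 ≤ g := norm_nonneg _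
      have hβ : 0 ≤ β := norm_nonneg _
      -- κ ≥ 1 lets the drift term, linear in ∇ζ, share the factor κ² with the quadratic ones.
      have hκ2 : (κ : ℝ) ≤ κ ^ 2 := by nlinarith
      have a4 : -A ≤ Λ * g * κ := by
        have : Λ * g * ‖Z‖ ≤ Λ * g * κ := by gcongr
        linarith [neg_le_abs A]
      have a5 : I ≤ β * κ ^ 2 := by
        have : β * ‖Z‖ ≤ β * κ ^ 2 := by gcongr; exact hZ.trans hκ2
        linarith [le_abs_self I]
      have b1 : 2 * Y ^ 2 * ζ x * I ≤ 2 * Y ^ 2 * (β * κ ^ 2) := by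
        calc 2 * Y ^ 2 * ζ x * I ≤ 2 * Y ^ 2 * ζ x * (β * κ ^ 2) := by gcongr
          _ ≤ 2 * Y ^ 2 * 1 * (β * κ ^ 2) := by gcongr
          _ = _ := by ring
      have b2 : -(4 * Y * ζ x * A) ≤
          ν * (ζ x ^ 2 * (c * g ^ 2)) + 4 * Λ ^ 2 / ν * (Y ^ 2 * κ ^ 2) := by
        have h1 := mul_le_mul_of_nonneg_left a4 (by positivity : 0 ≤ 4 * Y * ζ x)
        have h2 : ν * (ζ x ^ 2 * (c * c * g ^ 2)) + 4 * Λ ^ 2 / ν * (Y ^ 2 * κ ^ 2) -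
            4 * (Y * c) * ζ x * (Λ * g * κ) = ν * (ζ x * c * g - 2 * Λ / ν * Y * κ) ^ 2 := by
          field_simp
          ring
        rw [hcc, hcY] at h2
        have h3 : 0 ≤ ν * (ζ x * c * g - 2 * Λ / ν * Y * κ) ^ 2 := by positivity
        linarith
      have b3 : 2 * (ν * (ζ x ^ 2 * (c * g ^ 2))) ≤ 2 * ζ x ^ 2 * c * aform (a x) G G := by
        have := mul_le_mul_of_nonneg_left a1 (by positivity : 0 ≤ 2 * ζ x ^ 2 * c)
        linarith
      -- The good quadratic term from the logarithm is not needed here and is discarded by its sign.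
      have b4 : 0 ≤ aform (a x) G G * (2 * (Y * ζ x ^ 2)) := by
        have : 0 ≤ aform (a x) G G := le_trans (by positivity) a1
        positivity
      have b5 : ν / 2 * ‖(ζ x * c) • G + Y • Z‖ ^ 2 ≤
          ν * (ζ x ^ 2 * (c * g ^ 2)) + ν * (Y ^ 2 * κ ^ 2) := by
        have := mul_le_mul_of_nonneg_left hN (by positivity : 0 ≤ ν / 2)
        linarith
      have b6 : C * (Y ^ 2 * (1 + β)) = ν * (Y ^ 2 * κ ^ 2) +
          4 * Λ ^ 2 / ν * (Y ^ 2 * κ ^ 2) + 2 * (Y ^ 2 * κ ^ 2) +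
          (ν + 4 * Λ ^ 2 / ν) * (Y ^ 2 * κ ^ 2) * β + 2 * Y ^ 2 * (β * κ ^ 2) := by
        rw [hC]; ring
      have b7 : 0 ≤ 2 * (Y ^ 2 * κ ^ 2) + (ν + 4 * Λ ^ 2 / ν) * (Y ^ 2 * κ ^ 2) * β := by
        positivity
      linarith
    · rw [Set.indicator_of_notMem hxr]
      rw [mem_ball_zero_iff, not_lt] at hxr
      have hZ : Z = 0 := gradient_eq_zero_of_nonneg hζ0 (hζr x hxr)
      simp [hζr x hxr, hZ]
  rwa [integral_const_mul, integral_const_mul] at hsum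

end Energy

/-! ### Abstract drift and Sobolev bounds -/

/-- Hölder's inequality against `1 + |b|`, with exponent `s / 2` for the other factor. -/
structure DriftBound {n : ℕ} (b : Rn n → Rn n) (s N : ℝ) : Prop where
  nonneg : 0 ≤ N
  holder : ∀ g : Rn n → ℝ, Measurable g → (∀ x, 0 ≤ g x) → (∃ C, ∀ x, g x ≤ C) →
    ∫ x, g x * (1 + ‖b x‖) ∂(ballMeasure n) ≤ N * (∫ x, g x ^ (s / 2) ∂(ballMeasure n)) ^ (2 / s)

/-- The Sobolev inequality in the unit ball with exponent `σ` and constant `S`. -/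
def SobolevBound (n : ℕ) (σ S : ℝ) : Prop :=
  ∀ (f : Rn n → ℝ) (K : NNReal), LipschitzWith K f → (∀ x, 0 ≤ f x) →
    (∀ x, 1 ≤ ‖x‖ → f x = 0) →
    (∫ x, f x ^ σ ∂(ballMeasure n)) ^ (2 / σ) ≤ S * ∫ x, ‖gradient f x‖ ^ 2 ∂(ballMeasure n)

/-! ### The integral bound for the logarithm -/

section LogBound

variable {n : ℕ}

theorem sq_rpow_half {t : ℝ} (ht : 0 ≤ t) (s : ℝ) : (t ^ 2) ^ (s / 2) = t ^ s := by
  rw [← Real.rpow_natCast, ← Real.rpow_mul ht]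
  congr 1
  push_cast
  ring

set_option maxHeartbeats 1000000 in
-- With ζ the cone, three estimates form a loop: X = ∫|∇w|²ζ⁴ is controlled by ∫wζ³|b|, that by the
-- L_s norm of wζ³ through Hölder, and that again by X through Sobolev and Poincaré. The drift
-- integral is linear in w whereas X is quadratic, so Young's inequality closes the loop with no
-- smallness of b. The Lipschitz constant and the upper bound of `w` only ensure that the integrals
-- are finite.
theorem exists_log_bound (n : ℕ) {ν Λ s N S c L : ℝ} (hν : 0 < ν) (hS : 0 ≤ S) (hc : 0 < c) :
    ∃ T : ℝ, 0 < T ∧ ∀ (a : Rn n → Matrix (Fin n) (Fin n) ℝ) (b : Rn n → Rn n),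
      BallCoeff a b ν Λ → DriftBound b s N → SobolevBound n s S →
      ∀ (w : Rn n → ℝ) (K : NNReal) (M : ℝ), LipschitzWith K w → (∀ x, 0 ≤ w x) →
      (∀ x, w x ≤ M) → BallLogSubsolution a b w →
      ∀ Z : Set (Rn n), MeasurableSet Z → Z ⊆ Metric.ball 0 (1 / 2) → c ≤ (volume Z).toReal →
      (∀ x ∈ Z, w x ≤ L) →
      (∫ x, (w x * cone x ^ 3) ^ s ∂(ballMeasure n)) ^ (2 / s) ≤ T := by
  set V := (volume (Metric.ball (0 : Rn n) 1)).toReal with hV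
  have hV0 : 0 ≤ V := ENNReal.toReal_nonneg
  -- `A` and `B` arise from ∫|∇(wζ³)|² ≤ 2X + 18P ≤ AX + B, where P = ∫w²ζ⁴ is estimated by the
  -- Poincaré inequality.
  set A : ℝ := 2 + 18 * (128 * V * 2 ^ n / c) with hA
  set B : ℝ := 18 * (2 * L ^ 2 * V ^ 2 / c) with hB
  have hA0 : 0 ≤ A := by positivity
  have hB0 : 0 ≤ B := by positivity
  -- The sign of `N` is known only once a drift bound is given, and the constants must be fixed
  -- before that.
  set N' : ℝ := |N|
  set H : ℝ := V ^ (2 / s) with hH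
  have hH0 : 0 ≤ H := by positivity
  -- Small enough that 4τNSA ≤ ν/4, so half of the left side of the logarithmic estimate absorbs the
  -- returning X; `X₀` is the resulting bound for X.
  set τ : ℝ := ν / (16 * (N' * S * A + 1)) with hτ
  have hτ0 : 0 < τ := by positivity
  set X₀ : ℝ := 4 / ν * (8 * Λ ^ 2 / ν * V + 4 * τ * N' * S * B + N' * H / τ) with hX₀
  have hX₀0 : 0 ≤ X₀ := by positivity
  refine ⟨S * (A * X₀ + B) + 1, by positivity, ?_⟩
  intro a b hcoef hN hSob w K M hK h0 hM hw Z hZm hZ hcZ hL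
  have hNN : N' = N := abs_of_nonneg hN.nonneg
  have hcl := lipschitzWith_cone (n := n)
  have hcone : Continuous (cone : Rn n → ℝ) := hcl.continuous
  have hwc := hK.continuous
  have hwM (x : Rn n) : |w x| ≤ M := by rw [abs_of_nonneg (h0 x)]; exact hM x
  have hM0 : 0 ≤ M := (h0 0).trans (hM 0)
  have hcm (m : ℕ) (x : Rn n) : 0 ≤ cone x ^ m ∧ cone x ^ m ≤ 1 :=
    ⟨pow_nonneg (cone_nonneg x) m, pow_le_one₀ (cone_nonneg x) (cone_le_one x)⟩
  obtain ⟨L3, hL3⟩ := lipschitz_pow_of_le_one hcl cone_nonneg cone_le_one 3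
  obtain ⟨Lf, hLf⟩ := exists_lipschitzWith_mul hK hL3 hwM
    (B := 1) fun x => by rw [abs_of_nonneg (hcm 3 x).1]; exact (hcm 3 x).2
  have hf0 (x : Rn n) : 0 ≤ w x * cone x ^ 3 := mul_nonneg (h0 x) (hcm 3 x).1
  have hfM (x : Rn n) : w x * cone x ^ 3 ≤ M := by
    calc w x * cone x ^ 3 ≤ M * 1 := mul_le_mul (hM x) (hcm 3 x).2 (hcm 3 x).1 hM0
      _ = M := mul_one M
  set X := ∫ x, ‖gradient w x‖ ^ 2 * cone x ^ 4 ∂(ballMeasure n) with hX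
  set P := ∫ x, w x ^ 2 * cone x ^ 4 ∂(ballMeasure n) with hP
  set T := (∫ x, (w x * cone x ^ 3) ^ s ∂(ballMeasure n)) ^ (2 / s) with hT
  have hX0 : 0 ≤ X := integral_nonneg fun x => mul_nonneg (sq_nonneg _) (hcm 4 x).1
  have i1 : Integrable (fun x => ‖gradient w x‖ ^ 2 * cone x ^ 4) (ballMeasure n) := by
    refine integrable_ballMeasure_of_bound (C := K ^ 2 * 1) (((measurable_gradient
      _).norm.pow_const 2).mul (hcone.pow 4).measurable).aestronglyMeasurable fun x => ?_
    rw [abs_of_nonneg (mul_nonneg (sq_nonneg _) (hcm 4 x).1)]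
    exact mul_le_mul (pow_le_pow_left₀ (norm_nonneg _) (norm_gradient_le hK x) 2) (hcm 4 x).2
      (hcm 4 x).1 (by positivity)
  have i2 : Integrable (fun x => w x ^ 2 * cone x ^ 4) (ballMeasure n) := by
    refine integrable_ballMeasure_of_bound (C := M ^ 2 * 1)
      ((hwc.pow 2).mul (hcone.pow 4)).aestronglyMeasurable fun x => ?_
    rw [abs_of_nonneg (mul_nonneg (sq_nonneg _) (hcm 4 x).1)]
    exact mul_le_mul (pow_le_pow_left₀ (h0 x) (hM x) 2) (hcm 4 x).2
      (hcm 4 x).1 (by positivity)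
  have hPoin : P ≤ 128 * V * 2 ^ n / c * X + 2 * L ^ 2 * V ^ 2 / c := by
    have h1 := weighted_poincare w hK hwM hZm hZ (L := L)
      fun x hx => by rw [abs_of_nonneg (h0 x)]; exact hL x hx
    have hP0 : 0 ≤ P := integral_nonneg fun x => mul_nonneg (sq_nonneg _) (hcm 4 x).1
    have h2 : c * P ≤ 128 * V * 2 ^ n * X + 2 * L ^ 2 * V ^ 2 :=
      (mul_le_mul_of_nonneg_right hcZ hP0).trans h1
    have h3 : 128 * V * 2 ^ n / c * X + 2 * L ^ 2 * V ^ 2 / c =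
        (128 * V * 2 ^ n * X + 2 * L ^ 2 * V ^ 2) / c := by ring
    rw [h3, le_div_iff₀ hc]
    linarith
  have hgrad : ∫ x, ‖gradient (fun y => w y * cone y ^ 3) x‖ ^ 2 ∂(ballMeasure n) ≤
      2 * X + 18 * P := by
    rw [hX, hP, ← integral_const_mul, ← integral_const_mul,
      ← integral_add (i1.const_mul 2) (i2.const_mul 18)]
    refine integral_mono_ae ?_ ((i1.const_mul 2).add (i2.const_mul 18)) ?_
    · refine integrable_ballMeasure_of_bound (C := Lf ^ 2)
        ((measurable_gradient _).norm.pow_const 2).aestronglyMeasurable fun x => ?_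
      rw [abs_of_nonneg (sq_nonneg _)]
      exact pow_le_pow_left₀ (norm_nonneg _) (norm_gradient_le hLf x) 2
    · filter_upwards [ae_restrict_of_ae (ae_hasGradientAt hK),
        ae_restrict_of_ae (ae_hasGradientAt hcl)] with x hx hx'
      have e : gradient (fun y => w y * cone y ^ 3) x =
          (3 * w x * cone x ^ 2) • gradient cone x + (cone x ^ 3) • gradient w x := by
        refine (hasGradientAt_mul hx (hasGradientAt_comp (φ := fun t => t ^ 3)
          (hasDerivAt_pow 3 (cone x)) hx')).gradient.trans ?_
        push_cast
        module
      have hζ' : ‖gradient cone x‖ ≤ 1 := by simpa using norm_gradient_le hcl x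
      have z0 := cone_nonneg x
      have w0 := h0 x
      have h1 : ‖gradient (fun y => w y * cone y ^ 3) x‖ ≤
          3 * w x * cone x ^ 2 + cone x ^ 3 * ‖gradient w x‖ := by
        rw [e]
        refine (norm_add_le _ _).trans ?_
        rw [norm_smul, norm_smul, Real.norm_of_nonneg (by positivity),
          Real.norm_of_nonneg (by positivity)]
        have : 3 * w x * cone x ^ 2 * ‖gradient cone x‖ ≤ 3 * w x * cone x ^ 2 * 1 := by gcongr
        linarith
      -- The cubic power of the cone is chosen so that its derivative squared is of order ζ⁴, the
      -- Poincaré weight, while the other term carries ζ⁶ ≤ ζ⁴.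
      have h2 : cone x ^ 6 ≤ cone x ^ 4 := pow_le_pow_of_le_one z0 (cone_le_one x) (by norm_num)
      calc ‖gradient (fun y => w y * cone y ^ 3) x‖ ^ 2
          ≤ (3 * w x * cone x ^ 2 + cone x ^ 3 * ‖gradient w x‖) ^ 2 :=
            pow_le_pow_left₀ (norm_nonneg _) h1 2
        _ ≤ 2 * (‖gradient w x‖ ^ 2 * cone x ^ 6) + 18 * (w x ^ 2 * cone x ^ 4) := by
            nlinarith [sq_nonneg (3 * w x * cone x ^ 2 - cone x ^ 3 * ‖gradient w x‖)]
        _ ≤ _ := by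
            have := mul_le_mul_of_nonneg_left h2 (sq_nonneg ‖gradient w x‖)
            linarith
  have hTX : T ≤ S * (A * X + B) := by
    refine (hSob _ _ hLf hf0 fun x hx => by simp [cone_eq_zero hx]).trans ?_
    refine mul_le_mul_of_nonneg_left (hgrad.trans ?_) hS
    rw [hA, hB]
    linarith
  have hlog := hcoef.log_estimate hK h0 hM hw
  have hib : Integrable (fun x => 1 + ‖b x‖) (ballMeasure n) :=
    (integrable_const 1).add hcoef.integrable.norm
  have j1 : Integrable (fun x => (w x * cone x ^ 3) ^ 2 * (1 + ‖b x‖)) (ballMeasure n) := by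
    simp only [mul_comm _ (1 + ‖b _‖)]
    refine integrable_mul_of_bound hib (hLf.continuous.pow 2).measurable (C := M ^ 2) fun x => ?_
    rw [abs_of_nonneg (sq_nonneg _)]
    exact pow_le_pow_left₀ (hf0 x) (hfM x) 2
  have k1 : ∫ x, (w x * cone x ^ 3) ^ 2 * (1 + ‖b x‖) ∂(ballMeasure n) ≤ N * T := by
    have := hN.holder (fun x => (w x * cone x ^ 3) ^ 2) (hLf.continuous.pow 2).measurable
      (fun x => sq_nonneg _) ⟨M ^ 2, fun x => pow_le_pow_left₀ (hf0 x) (hfM x) 2⟩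
    simpa only [sq_rpow_half (hf0 _)] using this
  have k2 : ∫ x, (1 + ‖b x‖) ∂(ballMeasure n) ≤ N * H := by
    have := hN.holder (fun _ => 1) measurable_const (fun _ => zero_le_one) ⟨1, fun _ => le_rfl⟩
    simpa [Measure.real, hH, hV] using this
  -- Young in the form f ≤ τf² + 1/(4τ), integrated against 1 + |b|; Hölder is then applied to f²
  -- and to 1.
  have k3 : ∫ x, (w x * cone x ^ 3) * ‖b x‖ ∂(ballMeasure n) ≤
      τ * (N * T) + 1 / (4 * τ) * (N * H) := by
    calc ∫ x, (w x * cone x ^ 3) * ‖b x‖ ∂(ballMeasure n)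
        ≤ ∫ x, (τ * ((w x * cone x ^ 3) ^ 2 * (1 + ‖b x‖)) + 1 / (4 * τ) * (1 + ‖b x‖))
            ∂(ballMeasure n) := by
          refine integral_mono_of_nonneg (Eventually.of_forall fun x =>
            mul_nonneg (hf0 x) (norm_nonneg _)) ((j1.const_mul τ).add (hib.const_mul _))
            (Eventually.of_forall fun x => ?_)
          have hf := hf0 x
          have hb := norm_nonneg (b x)
          simp only
          set f := w x * cone x ^ 3
          have h1 : τ * (f ^ 2 * (1 + ‖b x‖)) + 1 / (4 * τ) * (1 + ‖b x‖) - f * (1 + ‖b x‖) =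
              τ * (f - 1 / (2 * τ)) ^ 2 * (1 + ‖b x‖) := by
            field_simp
            ring
          have h2 : 0 ≤ τ * (f - 1 / (2 * τ)) ^ 2 * (1 + ‖b x‖) := by positivity
          linarith
      _ = τ * ∫ x, (w x * cone x ^ 3) ^ 2 * (1 + ‖b x‖) ∂(ballMeasure n) +
            1 / (4 * τ) * ∫ x, (1 + ‖b x‖) ∂(ballMeasure n) := by
          rw [integral_add (j1.const_mul τ) (hib.const_mul _), integral_const_mul,
            integral_const_mul]
      _ ≤ _ := by gcongr
  have hXX : X ≤ X₀ := by
    have h1 : τ * (N * T) ≤ τ * (N * (S * (A * X + B))) := by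
      have := hN.nonneg
      gcongr
    have h2 : τ * (N * S * A) ≤ ν / 16 := by
      rw [hτ, hNN, div_mul_eq_mul_div, div_le_div_iff₀ (by have := hN.nonneg; positivity) (by norm_num)]
      nlinarith
    have h3 := mul_le_mul_of_nonneg_right h2 hX0
    have h4 : 1 / (4 * τ) * (N * H) = N * H / τ / 4 := by
      rw [one_div, mul_inv, div_div, div_eq_mul_inv, mul_inv]; ring
    rw [h4] at k3
    have h5 : ν / 4 * X ≤ 8 * Λ ^ 2 / ν * V + 4 * τ * N * S * B + N * H / τ := by linarith
    rw [hX₀, hNN]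
    have h6 : X = 4 / ν * (ν / 4 * X) := by field_simp
    rw [h6]
    gcongr
  calc T ≤ S * (A * X + B) := hTX
    _ ≤ S * (A * X₀ + B) := by gcongr
    _ ≤ _ := by linarith

end LogBound

/-! ### Fast geometric convergence -/

section Iteration

/-- The superlinear power beats the geometric growth Q^j if the start is small: with l = Q^(-1/α)
one has Q l^α = 1, and U j ≤ W l^j propagates by induction. -/
theorem tendsto_zero_of_le_geometric_rpow {U : ℕ → ℝ} {H Q α W : ℝ} (hU : ∀ j, 0 ≤ U j)
    (hH : 0 ≤ H) (hQ : 1 < Q) (hα : 0 < α) (hW : U 0 ≤ W)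
    (hHW : H * W ^ α ≤ Q ^ (-(1 / α))) (hstep : ∀ j, U (j + 1) ≤ H * Q ^ j * U j ^ (1 + α)) :
    Tendsto U atTop (𝓝 0) := by
  set l : ℝ := Q ^ (-(1 / α)) with hl
  have hQ0 : 0 < Q := by linarith
  have hW0 : 0 ≤ W := (hU 0).trans hW
  have hl0 : 0 < l := Real.rpow_pos_of_pos hQ0 _
  have hl1 : l < 1 := Real.rpow_lt_one_of_one_lt_of_neg hQ (by rw [neg_lt_zero]; positivity)
  have hQl : Q * l ^ α = 1 := by
    rw [hl, ← Real.rpow_mul hQ0.le]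
    have : -(1 / α) * α = -1 := by field_simp
    rw [this, Real.rpow_neg_one, mul_inv_cancel₀ hQ0.ne']
  have hdec (j : ℕ) : U j ≤ W * l ^ j := by
    induction j with
    | zero => simpa using hW
    | succ j ih =>
      have h1 : U j ^ (1 + α) ≤ (W * l ^ j) ^ (1 + α) :=
        Real.rpow_le_rpow (hU j) ih (by linarith)
      have h2 : (W * l ^ j) ^ (1 + α) = W * l ^ j * (W ^ α * (l ^ α) ^ j) := by
        rw [Real.rpow_add' (by positivity) (by positivity), Real.rpow_one,
          Real.mul_rpow hW0 (by positivity), ← Real.rpow_natCast, ← Real.rpow_natCast,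
          ← Real.rpow_mul hl0.le, ← Real.rpow_mul hl0.le, mul_comm α]
      calc U (j + 1) ≤ H * Q ^ j * (W * l ^ j) ^ (1 + α) := (hstep j).trans (by gcongr)
        _ = H * W ^ α * (W * l ^ j) * (Q * l ^ α) ^ j := by rw [h2, mul_pow]; ring
        _ = H * W ^ α * (W * l ^ j) := by rw [hQl, one_pow, mul_one]
        _ ≤ l * (W * l ^ j) := by gcongr
        _ = W * l ^ (j + 1) := by ring
  refine squeeze_zero hU hdec ?_
  simpa using (tendsto_pow_atTop_nhds_zero_of_lt_one hl0.le hl1).const_mul W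

end Iteration

/-! ### Radial cutoffs -/

section Cutoff

variable {n : ℕ}

/-- The cutoff function equal to `1` for `m (r - |x|) ≥ 1` and to `0` for `|x| ≥ r`. -/
def cutoff (m : NNReal) (r : ℝ) (x : Rn n) : ℝ := min (max (m * (r - ‖x‖)) 0) 1

theorem cutoff_nonneg (m : NNReal) (r : ℝ) (x : Rn n) : 0 ≤ cutoff m r x :=
  le_min (le_max_right _ _) zero_le_one

theorem cutoff_le_one (m : NNReal) (r : ℝ) (x : Rn n) : cutoff m r x ≤ 1 := min_le_right _ _

theorem cutoff_eq_zero (m : NNReal) {r : ℝ} {x : Rn n} (hx : r ≤ ‖x‖) : cutoff m r x = 0 := by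
  rw [cutoff, max_eq_right (mul_nonpos_of_nonneg_of_nonpos m.coe_nonneg (by linarith)),
    min_eq_left zero_le_one]

theorem cutoff_eq_one {m : NNReal} {r : ℝ} {x : Rn n} (hx : 1 ≤ m * (r - ‖x‖)) :
    cutoff m r x = 1 :=
  min_eq_right (hx.trans (le_max_left _ _))

theorem lipschitzWith_cutoff (m : NNReal) (r : ℝ) : LipschitzWith m (cutoff m r : Rn n → ℝ) := by
  refine LipschitzWith.min_const (LipschitzWith.max_const
    (LipschitzWith.of_dist_le_mul fun x y => ?_) 0) 1
  rw [Real.dist_eq, dist_eq_norm]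
  have h : (m : ℝ) * (r - ‖x‖) - m * (r - ‖y‖) = m * (‖y‖ - ‖x‖) := by ring
  rw [h, abs_mul, abs_of_nonneg m.coe_nonneg, abs_sub_comm]
  exact mul_le_mul_of_nonneg_left (abs_norm_sub_norm_le x y) m.coe_nonneg

end Cutoff

/-! ### De Giorgi iteration -/

section DeGiorgi

variable {n : ℕ} {a : Rn n → Matrix (Fin n) (Fin n) ℝ} {b : Rn n → Rn n} {ν Λ s σ N S : ℝ}

/-- The truncated energies `∫_{B_r} (w - k)₊ˢ`. -/
def truncEnergy (w : Rn n → ℝ) (s k r : ℝ) : ℝ :=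
  ∫ x, (Metric.ball (0 : Rn n) r).indicator (fun x => max (w x - k) 0 ^ s) x ∂(ballMeasure n)

theorem truncEnergy_nonneg (w : Rn n → ℝ) (s k r : ℝ) : 0 ≤ truncEnergy w s k r :=
  integral_nonneg fun x => Set.indicator_nonneg (fun _ _ =>
    Real.rpow_nonneg (le_max_right _ _) _) x

theorem integrable_trunc {w : Rn n → ℝ} (hw : Continuous w) {M : ℝ} (hM : ∀ x, w x ≤ M)
    (hs : 0 ≤ s) (k r : ℝ) : Integrable ((Metric.ball (0 : Rn n) r).indicator
      (fun x => max (w x - k) 0 ^ s)) (ballMeasure n) := by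
  have hc : Continuous fun x => max (w x - k) 0 ^ s :=
    Continuous.rpow_const (by fun_prop) fun x => Or.inr hs
  refine integrable_ballMeasure_of_bound (C := max (M - k) 0 ^ s)
    (hc.measurable.indicator Metric.isOpen_ball.measurableSet).aestronglyMeasurable fun x => ?_
  by_cases hx : x ∈ Metric.ball (0 : Rn n) r
  · rw [Set.indicator_of_mem hx, abs_of_nonneg (Real.rpow_nonneg (le_max_right _ _) _)]
    refine Real.rpow_le_rpow (le_max_right _ _) (max_le_max ?_ le_rfl) hs
    linarith [hM x]
  · rw [Set.indicator_of_notMem hx, abs_zero]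
    exact Real.rpow_nonneg (le_max_right _ _) _

/-- Caccioppoli and Hölder bound the gradient of the truncation by its L_s norm, and Sobolev returns
a higher L_σ norm. The surplus σ - s is cashed in as on {w > k + δ}: there (w - k)^s ≤ δ^(-(σ-s)) (w
- k)^σ. The energy thus reappears with exponent σ/s > 1. -/
theorem BallCoeff.truncEnergy_step (hc : BallCoeff a b ν Λ) (hN : DriftBound b s N)
    (hS0 : 0 ≤ S) (hSob : SobolevBound n σ S) (hs : 0 < s) (hsσ : s < σ) {w : Rn n → ℝ}
    {K : NNReal} {M : ℝ} (hK : LipschitzWith K w) (h0 : ∀ x, 0 ≤ w x) (hM : ∀ x, w x ≤ M)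
    (hw : BallLogSubsolution a b w) (k : ℝ) {δ r r' : ℝ} {m : NNReal} (hδ : 0 < δ) (hm : 1 ≤ m)
    (hr : r ≤ 1) (hmr : 1 ≤ m * (r - r')) :
    truncEnergy w s (k + δ) r' ≤ δ ^ (-(σ - s)) *
      (S * (2 / ν * ((ν + 4 * Λ ^ 2 / ν + 2) * m ^ 2 *
        (N * truncEnergy w s k r ^ (2 / s))))) ^ (σ / 2) := by
  have hν := hc.nu_pos
  have hσ : 0 < σ := hs.trans hsσ
  have hwc := hK.continuous
  have hm0 : (0 : ℝ) < m := by
    have : (1 : ℝ) ≤ m := by exact_mod_cast hm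
    linarith
  have hy0 (x : Rn n) : 0 ≤ max (w x - k) 0 := le_max_right _ _
  have hyM (x : Rn n) : max (w x - k) 0 ≤ max (M - k) 0 :=
    max_le_max (by linarith [hM x]) le_rfl
  have hLy := lipschitz_posPart hK k
  have hLζ := lipschitzWith_cutoff (n := n) m r
  have hz0 := cutoff_nonneg (n := n) m r
  have hz1 := cutoff_le_one (n := n) m r
  obtain ⟨Lf, hLf⟩ := exists_lipschitzWith_mul hLy hLζ (A := max (M - k) 0)
    (fun x => by rw [abs_of_nonneg (hy0 x)]; exact hyM x)
    (B := 1) fun x => by rw [abs_of_nonneg (hz0 x)]; exact hz1 x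
  have hf0 (x : Rn n) : 0 ≤ max (w x - k) 0 * cutoff m r x := mul_nonneg (hy0 x) (hz0 x)
  have h1 := hSob _ _ hLf hf0 fun x hx => by rw [cutoff_eq_zero m (hr.trans hx), mul_zero]
  have h2 := hc.caccioppoli hK h0 hM hw k hLζ hm hz0 hz1 hr fun x hx => cutoff_eq_zero m hx
  have hind : ∀ x, (Metric.ball (0 : Rn n) r).indicator (fun x => max (w x - k) 0 ^ 2) x ^ (s / 2) =
      (Metric.ball (0 : Rn n) r).indicator (fun x => max (w x - k) 0 ^ s) x := fun x => by
    by_cases hx : x ∈ Metric.ball (0 : Rn n) r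
    · rw [Set.indicator_of_mem hx, Set.indicator_of_mem hx, sq_rpow_half (hy0 x)]
    · rw [Set.indicator_of_notMem hx, Set.indicator_of_notMem hx, Real.zero_rpow (by positivity)]
  have h3 := hN.holder ((Metric.ball (0 : Rn n) r).indicator (fun x => max (w x - k) 0 ^ 2))
    ((hLy.continuous.pow 2).measurable.indicator Metric.isOpen_ball.measurableSet)
    (fun x => Set.indicator_nonneg (fun x _ => sq_nonneg _) x)
    ⟨max (M - k) 0 ^ 2, fun x => Set.indicator_le' (fun _ _ => pow_le_pow_left₀ (hy0 x) (hyM x) 2)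
      (fun x _ => sq_nonneg _) x⟩
  simp only [hind] at h3
  set I := ∫ x, (max (w x - k) 0 * cutoff m r x) ^ σ ∂(ballMeasure n) with hI
  have hI0 : 0 ≤ I := integral_nonneg fun x => Real.rpow_nonneg (hf0 x) _
  have h4 : I ^ (2 / σ) ≤ S * (2 / ν * ((ν + 4 * Λ ^ 2 / ν + 2) * m ^ 2 *
        (N * truncEnergy w s k r ^ (2 / s)))) := by
    refine h1.trans (mul_le_mul_of_nonneg_left ?_ hS0)
    have h5 := h2.trans (mul_le_mul_of_nonneg_left h3 (by positivity))
    rw [div_mul_eq_mul_div, le_div_iff₀ hν]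
    unfold truncEnergy
    linarith
  have h6 : I ≤ (S * (2 / ν * ((ν + 4 * Λ ^ 2 / ν + 2) * m ^ 2 *
        (N * truncEnergy w s k r ^ (2 / s))))) ^ (σ / 2) := by
    refine le_trans (le_of_eq ?_) (Real.rpow_le_rpow (by positivity) h4 (by positivity))
    rw [← Real.rpow_mul hI0]
    have : 2 / σ * (σ / 2) = 1 := by field_simp
    rw [this, Real.rpow_one]
  have hfM (x : Rn n) : max (w x - k) 0 * cutoff m r x ≤ max (M - k) 0 := by
    calc _ ≤ max (M - k) 0 * 1 := mul_le_mul (hyM x) (hz1 x) (hz0 x) (le_max_right _ _)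
      _ = _ := mul_one _
  have hIi : Integrable (fun x => (max (w x - k) 0 * cutoff m r x) ^ σ) (ballMeasure n) := by
    refine integrable_ballMeasure_of_bound (C := max (M - k) 0 ^ σ)
      (hLf.continuous.rpow_const fun x => Or.inr hσ.le).aestronglyMeasurable fun x => ?_
    rw [abs_of_nonneg (Real.rpow_nonneg (hf0 x) _)]
    exact Real.rpow_le_rpow (hf0 x) (hfM x) hσ.le
  refine le_trans ?_ (mul_le_mul_of_nonneg_left h6 (by positivity))
  rw [hI, ← integral_const_mul]
  refine integral_mono (integrable_trunc hwc hM hs.le _ _) (hIi.const_mul _) fun x => ?_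
  have hrhs : 0 ≤ δ ^ (-(σ - s)) * (max (w x - k) 0 * cutoff m r x) ^ σ :=
    mul_nonneg (by positivity) (Real.rpow_nonneg (hf0 x) _)
  by_cases hx : x ∈ Metric.ball (0 : Rn n) r'
  · rw [Set.indicator_of_mem hx]
    rw [mem_ball_zero_iff] at hx
    rcases le_or_gt (w x) (k + δ) with hwk | hwk
    · rw [max_eq_right (by linarith), Real.zero_rpow hs.ne']
      exact hrhs
    · have hone : cutoff m r x = 1 := cutoff_eq_one (hmr.trans (by gcongr))
      rw [hone, mul_one, max_eq_left (by linarith), max_eq_left (by linarith)]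
      have hp : 0 < w x - k := by linarith
      calc (w x - (k + δ)) ^ s ≤ (w x - k) ^ s :=
            Real.rpow_le_rpow (by linarith) (by linarith) hs.le
        _ = (w x - k) ^ (-(σ - s)) * (w x - k) ^ σ := by
            rw [← Real.rpow_add hp]; congr 1; ring
        _ ≤ δ ^ (-(σ - s)) * (w x - k) ^ σ := by
            refine mul_le_mul_of_nonneg_right ?_ (Real.rpow_nonneg hp.le _)
            exact Real.rpow_le_rpow_of_nonpos hδ (by linarith) (by linarith)
  · rw [Set.indicator_of_notMem hx]
    exact hrhs

/-- Iterate over levels rising to `k` and balls shrinking to B_{1/2}. The initial energy is bounded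
independently of `k`, while the recursion constant decays like k^(-(σ-s)), so a large `k` drives the
energies to 0. -/
theorem exists_sup_bound (n : ℕ) {ν Λ s σ N S T : ℝ} (hν : 0 < ν) (hS : 0 ≤ S) (hs : 0 < s)
    (hsσ : s < σ) :
    ∃ k : ℝ, 0 < k ∧ ∀ (a : Rn n → Matrix (Fin n) (Fin n) ℝ) (b : Rn n → Rn n),
      BallCoeff a b ν Λ → DriftBound b s N → SobolevBound n σ S →
      ∀ (w : Rn n → ℝ) (K : NNReal) (M : ℝ), LipschitzWith K w → (∀ x, 0 ≤ w x) →
      (∀ x, w x ≤ M) → BallLogSubsolution a b w →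
      (∫ x, (w x * cone x ^ 3) ^ s ∂(ballMeasure n)) ^ (2 / s) ≤ T →
      ∀ x, ‖x‖ < 1 / 2 → w x ≤ k := by
  have hσ : 0 < σ := hs.trans hsσ
  -- Bound for the starting energy on B_{3/4}, where the cube of the cone is at least 1/64.
  set W : ℝ := 64 ^ s * T ^ (s / 2) with hW
  set D : ℝ := S * (2 / ν * ((ν + 4 * Λ ^ 2 / ν + 2) * 64 * |N|)) with hD
  have hD0 : 0 ≤ D := by positivity
  set E : ℝ := 2 ^ (σ - s) * D ^ (σ / 2) with hE
  -- Per step the level gap contributes a factor 2^(σ-s) and the slope of the cutoff a factor 2^σ.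
  set Q : ℝ := 2 ^ (2 * σ - s) with hQ
  have hQ1 : 1 < Q := Real.one_lt_rpow one_lt_two (by linarith)
  set α : ℝ := σ / s - 1 with hα
  have hα0 : 0 < α := by rw [hα, sub_pos, one_lt_div hs]; exact hsσ
  obtain ⟨k, hk0, hk⟩ : ∃ k : ℝ, 0 < k ∧ k ^ (-(σ - s)) * E * W ^ α ≤ Q ^ (-(1 / α)) := by
    have h1 : Tendsto (fun k : ℝ => k ^ (-(σ - s)) * E * W ^ α) atTop (𝓝 (0 * E * W ^ α)) :=
      ((tendsto_rpow_neg_atTop (by linarith)).mul_const E).mul_const _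
    rw [zero_mul, zero_mul] at h1
    have h2 := h1.eventually_le_const (Real.rpow_pos_of_pos (by linarith) (-(1 / α)) :
      (0 : ℝ) < Q ^ (-(1 / α)))
    obtain ⟨k, hk, hk'⟩ := (h2.and (eventually_gt_atTop 0)).exists
    exact ⟨k, hk', hk⟩
  refine ⟨k, hk0, ?_⟩
  intro a b hc hN hSob w K M hK h0 hM hw hTw
  have hNN : |N| = N := abs_of_nonneg hN.nonneg
  have hwc := hK.continuous
  set r : ℕ → ℝ := fun j => 1 / 2 + 1 / 4 * (1 / 2) ^ j with hr
  set κ : ℕ → ℝ := fun j => k * (1 - (1 / 2) ^ j) with hκ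
  set U : ℕ → ℝ := fun j => truncEnergy w s (κ j) (r j) with hU
  have hstep (j : ℕ) : U (j + 1) ≤ k ^ (-(σ - s)) * E * Q ^ j * U j ^ (1 + α) := by
    have hU0 : 0 ≤ U j := truncEnergy_nonneg _ _ _ _
    have hδ : 0 < k * (1 / 2) ^ (j + 1) := by positivity
    have hr1 : r j ≤ 1 := by
      have : (1 / 2 : ℝ) ^ j ≤ 1 := pow_le_one₀ (by norm_num) (by norm_num)
      simp only [hr]; linarith
    have h1 := hc.truncEnergy_step hN hS hSob hs hsσ hK h0 hM hw (κ j) (r := r j)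
      -- The slope is the reciprocal of r_j - r_{j+1} = 2^(-j)/8.
      (r' := r (j + 1)) (m := 8 * 2 ^ j) hδ ?_ hr1 ?_
    · have e1 : κ j + k * (1 / 2) ^ (j + 1) = κ (j + 1) := by simp only [hκ]; ring
      rw [e1] at h1
      refine h1.trans (le_of_eq ?_)
      have e2 : S * (2 / ν * ((ν + 4 * Λ ^ 2 / ν + 2) * ((8 * 2 ^ j : NNReal) : ℝ) ^ 2 *
          (N * U j ^ (2 / s)))) = D * ((2 ^ j) ^ 2 * U j ^ (2 / s)) := by
        rw [hD, hNN]; push_cast; ring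
      change (k * (1 / 2) ^ (j + 1)) ^ (-(σ - s)) * (S * (2 / ν * ((ν + 4 * Λ ^ 2 / ν + 2) *
        ((8 * 2 ^ j : NNReal) : ℝ) ^ 2 * (N * U j ^ (2 / s))))) ^ (σ / 2) = _
      rw [e2, Real.mul_rpow hk0.le (by positivity), Real.mul_rpow (x := D) hD0 (by positivity),
        Real.mul_rpow (x := ((2 : ℝ) ^ j) ^ 2) (by positivity) (by positivity)]
      have e3 : ((2 ^ j : ℝ) ^ 2) ^ (σ / 2) = 2 ^ (j * σ) := by
        rw [sq_rpow_half (by positivity), ← Real.rpow_natCast, ← Real.rpow_mul (by norm_num)]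
      have e4 : (U j ^ (2 / s)) ^ (σ / 2) = U j ^ (1 + α) := by
        rw [← Real.rpow_mul hU0]
        congr 1
        rw [hα]
        field_simp
        ring
      have e5 : ((1 / 2 : ℝ) ^ (j + 1)) ^ (-(σ - s)) = 2 ^ ((j + 1) * (σ - s)) := by
        rw [one_div, inv_pow, Real.inv_rpow (by positivity), ← Real.rpow_neg (by positivity),
          neg_neg, ← Real.rpow_natCast, ← Real.rpow_mul (by norm_num)]
        push_cast
        rfl
      have e6 : (2 : ℝ) ^ ((j + 1) * (σ - s)) * 2 ^ (j * σ) = 2 ^ (σ - s) * Q ^ j := by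
        rw [hQ, ← Real.rpow_natCast, ← Real.rpow_mul (by norm_num), ← Real.rpow_add (by norm_num),
          ← Real.rpow_add (by norm_num)]
        congr 1
        ring
      rw [e3, e4, e5, hE]
      calc _ = k ^ (-(σ - s)) * ((2 : ℝ) ^ ((j + 1) * (σ - s)) * 2 ^ (j * σ)) * D ^ (σ / 2) *
            U j ^ (1 + α) := by ring
        _ = _ := by rw [e6]; ring
    · have h8 : (1 : NNReal) ≤ 2 ^ j := one_le_pow₀ (by norm_num)
      calc (1 : NNReal) ≤ 8 * 1 := by norm_num
        _ ≤ 8 * 2 ^ j := by gcongr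
    · have : r j - r (j + 1) = 1 / 8 * (1 / 2) ^ j := by simp only [hr]; ring
      rw [this]
      push_cast
      rw [one_div_pow]
      have : (2 : ℝ) ^ j ≠ 0 := by positivity
      field_simp
      norm_num
  have hU0W : U 0 ≤ W := by
    have hcone : Continuous (cone : Rn n → ℝ) := lipschitzWith_cone.continuous
    have hf0 (x : Rn n) : 0 ≤ w x * cone x ^ 3 := mul_nonneg (h0 x) (pow_nonneg (cone_nonneg x) 3)
    have hM0 : 0 ≤ M := (h0 0).trans (hM 0)
    set I := ∫ x, (w x * cone x ^ 3) ^ s ∂(ballMeasure n) with hI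
    have hI0 : 0 ≤ I := integral_nonneg fun x => Real.rpow_nonneg (hf0 x) _
    have h1 : I ≤ T ^ (s / 2) := by
      refine le_trans (le_of_eq ?_) (Real.rpow_le_rpow (by positivity) hTw (by positivity))
      rw [← Real.rpow_mul hI0]
      have : 2 / s * (s / 2) = 1 := by field_simp
      rw [this, Real.rpow_one]
    refine le_trans ?_ (mul_le_mul_of_nonneg_left h1 (by positivity))
    rw [hI, ← integral_const_mul]
    refine integral_mono (integrable_trunc hwc hM hs.le _ _) (Integrable.const_mul ?_ _)
      fun x => ?_
    · refine integrable_ballMeasure_of_bound (C := M ^ s)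
        ((hwc.mul (hcone.pow 3)).rpow_const fun x => Or.inr hs.le).aestronglyMeasurable fun x => ?_
      rw [abs_of_nonneg (Real.rpow_nonneg (hf0 x) _)]
      refine Real.rpow_le_rpow (hf0 x) ?_ hs.le
      calc w x * cone x ^ 3 ≤ M * 1 := mul_le_mul (hM x)
            (pow_le_one₀ (cone_nonneg x) (cone_le_one x)) (pow_nonneg (cone_nonneg x) 3) hM0
        _ = M := mul_one M
    · by_cases hx : x ∈ Metric.ball (0 : Rn n) (r 0)
      · rw [Set.indicator_of_mem hx, ← Real.mul_rpow (by norm_num) (hf0 x)]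
        rw [mem_ball_zero_iff] at hx
        have hx' : ‖x‖ < 3 / 4 := by simp only [hr] at hx; norm_num at hx; exact hx
        have hz : 1 / 4 ≤ cone x := by rw [cone_eq (by linarith)]; linarith
        have hz3 : 1 / 64 ≤ cone x ^ 3 := by
          calc (1 / 64 : ℝ) = (1 / 4) ^ 3 := by norm_num
            _ ≤ cone x ^ 3 := by gcongr
        have hw0 := h0 x
        refine Real.rpow_le_rpow (le_max_right _ _) (max_le ?_ (by have := hf0 x; positivity)) hs.le
        simp only [hκ]
        nlinarith
      · rw [Set.indicator_of_notMem hx]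
        exact mul_nonneg (by positivity) (Real.rpow_nonneg (hf0 x) _)
  have hlim : Tendsto U atTop (𝓝 0) :=
    tendsto_zero_of_le_geometric_rpow (fun j => truncEnergy_nonneg _ _ _ _) (by positivity)
      hQ1 hα0 hU0W hk hstep
  have hzero : truncEnergy w s k (1 / 2) = 0 := by
    refine le_antisymm (ge_of_tendsto' hlim fun j => ?_) (truncEnergy_nonneg _ _ _ _)
    refine integral_mono (integrable_trunc hwc hM hs.le _ _) (integrable_trunc hwc hM hs.le _ _)
      fun x => ?_
    by_cases hx : x ∈ Metric.ball (0 : Rn n) (1 / 2)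
    · have hp : (0 : ℝ) < (1 / 2) ^ j := by positivity
      have hx' : x ∈ Metric.ball (0 : Rn n) (r j) :=
        Metric.ball_subset_ball (by simp only [hr]; linarith) hx
      rw [Set.indicator_of_mem hx, Set.indicator_of_mem hx']
      refine Real.rpow_le_rpow (le_max_right _ _) (max_le_max ?_ le_rfl) hs.le
      simp only [hκ]
      nlinarith
    · rw [Set.indicator_of_notMem hx]
      exact Set.indicator_nonneg (fun x _ => Real.rpow_nonneg (le_max_right _ _) _) x
  have hae := (integral_eq_zero_iff_of_nonneg (fun x => Set.indicator_nonneg (fun x _ =>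
    Real.rpow_nonneg (le_max_right _ _) _) x) (integrable_trunc hwc hM hs.le k (1 / 2))).1 hzero
  have hae' : (fun x => max (w x - k) 0 ^ s) =ᵐ[volume.restrict (Metric.ball (0 : Rn n) (1 / 2))]
      fun _ => 0 := by
    have h1 := ae_restrict_of_ae_restrict_of_subset
      (Metric.ball_subset_ball (by norm_num : (1 / 2 : ℝ) ≤ 1)) hae
    filter_upwards [h1, ae_restrict_mem Metric.isOpen_ball.measurableSet] with x hx hx'
    rwa [Set.indicator_of_mem hx'] at hx
  -- Vanishing energy gives w ≤ k only almost everywhere; continuity upgrades it to every point of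
  -- the open ball.
  have heq := Measure.eqOn_open_of_ae_eq hae' Metric.isOpen_ball
    (Continuous.continuousOn (Continuous.rpow_const (by fun_prop) fun x => Or.inr hs.le))
    continuousOn_const
  intro x hx
  have h1 := heq (mem_ball_zero_iff.2 hx)
  simp only at h1
  rw [Real.rpow_eq_zero (le_max_right _ _) hs.ne'] at h1
  linarith [le_max_left (w x - k) 0]

end DeGiorgi

/-! ### The growth lemma -/

section LowerBound

variable {n : ℕ}

/-- Half of the exponent 2q/(q-1) is the Hölder conjugate of q, and Minkowski's inequality bounds
the L_q norm of 1 + |b|. -/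
theorem driftBound_of_eLpNorm_le {b : Rn n → Rn n} {q N : ℝ} (hq : 1 < q) (hN : 0 ≤ N)
    (hb : MemLp b (ENNReal.ofReal q) (ballMeasure n))
    (hbN : eLpNorm b (ENNReal.ofReal q) (ballMeasure n) ≤ ENNReal.ofReal N) :
    DriftBound b (2 * (q / (q - 1)))
      ((eLpNorm (fun _ : Rn n => (1 : ℝ)) (ENNReal.ofReal q) (ballMeasure n)).toReal + N) := by
  refine ⟨by positivity, fun g hg hg0 ⟨C, hC⟩ => ?_⟩
  have hq0 : 0 < q := by linarith
  have hone : MemLp (fun _ : Rn n => (1 : ℝ)) (ENNReal.ofReal q) (ballMeasure n) := memLp_const 1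
  have hf : MemLp (fun x => 1 + ‖b x‖) (ENNReal.ofReal q) (ballMeasure n) := hone.add hb.norm
  have hgp : MemLp g (ENNReal.ofReal (q / (q - 1))) (ballMeasure n) :=
    MemLp.of_bound hg.aestronglyMeasurable C (Eventually.of_forall fun x => by
      rw [Real.norm_of_nonneg (hg0 x)]; exact hC x)
  have hconj : (q / (q - 1)).HolderConjugate q := (Real.HolderConjugate.conjExponent hq).symm
  have h1 := integral_mul_le_Lp_mul_Lq_of_nonneg hconj (Eventually.of_forall hg0)
    (Eventually.of_forall fun x => by positivity : 0 ≤ᵐ[ballMeasure n] fun x => 1 + ‖b x‖) hgp hf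
  have h2 : (∫ x, (1 + ‖b x‖) ^ q ∂(ballMeasure n)) ^ (1 / q) ≤
      (eLpNorm (fun _ : Rn n => (1 : ℝ)) (ENNReal.ofReal q) (ballMeasure n)).toReal + N := by
    have h3 : eLpNorm (fun x => 1 + ‖b x‖) (ENNReal.ofReal q) (ballMeasure n) ≤
        eLpNorm (fun _ : Rn n => (1 : ℝ)) (ENNReal.ofReal q) (ballMeasure n) +
          ENNReal.ofReal N := by
      refine (eLpNorm_add_le hone.1 hb.norm.1 ?_).trans (add_le_add le_rfl ?_)
      · rw [ENNReal.one_le_ofReal]; exact hq.le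
      · rwa [eLpNorm_norm]
    rw [hf.eLpNorm_eq_integral_rpow_norm (by simpa using hq0) ENNReal.ofReal_ne_top,
      ENNReal.toReal_ofReal hq0.le, ← ENNReal.ofReal_toReal hone.eLpNorm_ne_top,
      ← ENNReal.ofReal_add ENNReal.toReal_nonneg hN,
      ENNReal.ofReal_le_ofReal_iff (by positivity)] at h3
    refine le_trans (le_of_eq ?_) h3
    rw [one_div]
    congr 1
    refine integral_congr_ae (Eventually.of_forall fun x => ?_)
    simp only
    rw [Real.norm_of_nonneg (by positivity)]
  have e1 : 2 * (q / (q - 1)) / 2 = q / (q - 1) := by ring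
  have e2 : 2 / (2 * (q / (q - 1))) = 1 / (q / (q - 1)) := by
    rw [← div_div, div_self two_ne_zero]
  rw [e1, e2]
  refine h1.trans ?_
  rw [mul_comm]
  refine mul_le_mul_of_nonneg_right h2 (Real.rpow_nonneg (integral_nonneg fun x => ?_) _)
  exact Real.rpow_nonneg (hg0 x) _

theorem BallSupersolution.affine {a : Rn n → Matrix (Fin n) (Fin n) ℝ} {b : Rn n → Rn n}
    {v : Rn n → ℝ} (hv : BallSupersolution a b v) {K : NNReal} (hK : LipschitzWith K v) {c : ℝ}
    (hc : 0 ≤ c) (d : ℝ) : BallSupersolution a b fun x => c * v x + d := by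
  intro η hη hη0
  refine (mul_nonneg hc (hv η hη hη0)).trans_eq ?_
  rw [← integral_const_mul]
  refine integral_congr_ae ?_
  filter_upwards [ae_restrict_of_ae (ae_hasGradientAt hK)] with x hx
  have e : gradient (fun y => c * v y + d) x = c • gradient v x :=
    (hasGradientAt_comp (φ := fun t => c * t + d)
      (by simpa using ((hasDerivAt_id (v x)).const_mul c).add_const d) hx).gradient
  rw [e, aform_smul_left, inner_smul_right]
  ring

/-- Growth lemma: a supersolution with values in `[0, 1]` that is at least `1 / 2` on half of the
ball of radius `1 / 2` is bounded below in that ball. -/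
theorem exists_lower_bound (hn : 2 ≤ n) {ν Λ q N : ℝ} (hν : 0 < ν) (hq : (n : ℝ) / 2 < q)
    (hN : 0 ≤ N) :
    ∃ δ : ℝ, 0 < δ ∧ ∀ (a : Rn n → Matrix (Fin n) (Fin n) ℝ) (b : Rn n → Rn n),
      BallCoeff a b ν Λ → MemLp b (ENNReal.ofReal q) (ballMeasure n) →
      eLpNorm b (ENNReal.ofReal q) (ballMeasure n) ≤ ENNReal.ofReal N →
      ∀ (v : Rn n → ℝ) (K : NNReal), LipschitzWith K v → (∀ x, 0 ≤ v x) → (∀ x, v x ≤ 1) →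
      BallSupersolution a b v →
      volume (Metric.ball (0 : Rn n) (1 / 2)) ≤
        2 * volume (Metric.ball (0 : Rn n) (1 / 2) ∩ {x | 1 / 2 ≤ v x}) →
      ∀ x, ‖x‖ < 1 / 2 → δ ≤ v x := by
  have hn0 : (2 : ℝ) ≤ n := by exact_mod_cast hn
  have hq1 : 1 < q := by linarith
  set s : ℝ := 2 * (q / (q - 1)) with hs
  have hs0 : 0 < s := by
    have : 0 < q - 1 := by linarith
    positivity
  have hs' : 1 / s = 1 / 2 - 1 / (2 * q) := by
    have : q - 1 ≠ 0 := by linarith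
    rw [hs]; field_simp
  -- Here q > n/2 enters: it says exactly that `s` is strictly subcritical.
  have hsn : 1 / 2 - 1 / (n : ℝ) < 1 / s := by
    rw [hs']
    have : 1 / (2 * q) < 1 / (n : ℝ) := one_div_lt_one_div_of_lt (by linarith) (by linarith)
    linarith
  have hn2 : 0 ≤ 1 / 2 - 1 / (n : ℝ) := by
    rw [sub_nonneg]
    exact one_div_le_one_div_of_le two_pos hn0
  have hs1 : 0 < 1 / s := by positivity
  -- 1/σ is the midpoint between 1/s and the critical value, so σ is still subcritical and exceeds
  -- `s`.
  set σ : ℝ := 2 / (1 / s + (1 / 2 - 1 / (n : ℝ))) with hσ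
  have hσ0 : 0 < σ := by positivity
  have hσ' : 1 / σ = (1 / s + (1 / 2 - 1 / (n : ℝ))) / 2 := by rw [hσ, one_div_div]
  have hσn : 1 / 2 - 1 / (n : ℝ) < 1 / σ := by rw [hσ']; linarith
  have hsσ : s < σ := by
    rw [← one_div_lt_one_div hσ0 hs0, hσ']; linarith
  obtain ⟨S, hS, hSob⟩ := sobolev_of_lipschitz hn hs0 hsn
  obtain ⟨S', hS', hSob'⟩ := sobolev_of_lipschitz hn hσ0 hσn
  set N' : ℝ :=
    (eLpNorm (fun _ : Rn n => (1 : ℝ)) (ENNReal.ofReal q) (ballMeasure n)).toReal + N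
  set c : ℝ := (volume (Metric.ball (0 : Rn n) (1 / 2))).toReal / 2 with hc
  have hc0 : 0 < c := by
    have : 0 < (volume (Metric.ball (0 : Rn n) (1 / 2))).toReal :=
      ENNReal.toReal_pos (Metric.measure_ball_pos _ _ (by norm_num)).ne' measure_ball_lt_top.ne
    positivity
  obtain ⟨T, -, hT⟩ := exists_log_bound n (ν := ν) (Λ := Λ) (s := s) (N := N') (S := S) (c := c)
    (L := Real.log 2) hν hS.le hc0
  obtain ⟨k, -, hk⟩ := exists_sup_bound n (ν := ν) (Λ := Λ) (s := s) (σ := σ) (N := N') (S := S')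
    (T := T) hν hS'.le hs0 hsσ
  refine ⟨Real.exp (-k), Real.exp_pos _, ?_⟩
  intro a b hcoef hb hbN v K hK hv0 hv1 hv hvol x hx
  have hdrift : DriftBound b s N' := driftBound_of_eLpNorm_le hq1 hN hb hbN
  -- Since `v` may vanish, the logarithm is taken of (v + ε)/(1 + ε), which stays in [0, 1] and is
  -- still at least 1/2 where `v` is. The bound `k` does not depend on ε.
  refine le_of_forall_pos_le_add fun ε hε => ?_
  set d : ℝ := (1 + ε)⁻¹ with hd
  have hd0 : 0 < d := by positivity
  have hdd : d * (1 + ε) = 1 := inv_mul_cancel₀ (by positivity)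
  set vε : Rn n → ℝ := fun x => d * v x + d * ε with hvε
  have hvε_low (x : Rn n) : d * ε ≤ vε x := by
    have := mul_nonneg hd0.le (hv0 x)
    simp only [hvε]; linarith
  have hvε_one (x : Rn n) : vε x ≤ 1 := by
    have := mul_le_mul_of_nonneg_left (hv1 x) hd0.le
    simp only [hvε]; linarith
  have hvεL : LipschitzWith (d.toNNReal * K) vε := by
    refine LipschitzWith.of_dist_le_mul fun x y => ?_
    have h := hK.dist_le_mul x y
    rw [Real.dist_eq] at h ⊢
    have e : vε x - vε y = d * (v x - v y) := by simp only [hvε]; ring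
    rw [e, abs_mul, abs_of_pos hd0, NNReal.coe_mul, Real.coe_toNNReal d hd0.le, mul_assoc]
    gcongr
  have hε0 : 0 < d * ε := by positivity
  have hvεpos (x : Rn n) : 0 < vε x := hε0.trans_le (hvε_low x)
  have hw := (hv.affine hK hd0.le (d * ε)).neg_log hvεL hε0 hvε_low hvε_one
  obtain ⟨Kw, hKw⟩ : ∃ L, LipschitzWith L fun x => -Real.log (vε x) := by
    refine exists_lipschitzWith_comp hvεL (s := d * ε) (t := 1) (φ := fun t => -Real.log t)
      (φ' := fun t => -t⁻¹) (fun x => ⟨hvε_low x, hvε_one x⟩)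
      (fun y hy => (Real.hasDerivAt_log (hε0.trans_le hy.1).ne').neg) ?_
    exact (continuousOn_id.inv₀ fun y hy => (hε0.trans_le hy.1).ne').neg
  have hw0 (x : Rn n) : 0 ≤ -Real.log (vε x) := by
    rw [neg_nonneg]; exact Real.log_nonpos (hvεpos x).le (hvε_one x)
  have hwM (x : Rn n) : -Real.log (vε x) ≤ -Real.log (d * ε) :=
    neg_le_neg (Real.log_le_log hε0 (hvε_low x))
  set Z : Set (Rn n) := Metric.ball (0 : Rn n) (1 / 2) ∩ {x | 1 / 2 ≤ v x} with hZ
  have hZm : MeasurableSet Z := Metric.isOpen_ball.measurableSet.inter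
    (measurableSet_le measurable_const hK.continuous.measurable)
  have hZs : Z ⊆ Metric.ball 0 (1 / 2) := Set.inter_subset_left
  have hZc : c ≤ (volume Z).toReal := by
    have hfin : 2 * volume Z ≠ ⊤ := ENNReal.mul_ne_top (by simp)
      ((measure_mono hZs).trans_lt measure_ball_lt_top).ne
    have := ENNReal.toReal_mono hfin hvol
    rw [ENNReal.toReal_mul, ENNReal.toReal_ofNat] at this
    rw [hc]; linarith
  have hZw (x : Rn n) (hx : x ∈ Z) : -Real.log (vε x) ≤ Real.log 2 := by
    rw [← Real.log_inv]
    refine Real.log_le_log (inv_pos.2 (hvεpos x)) ?_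
    rw [inv_le_comm₀ (hvεpos x) two_pos]
    have := mul_le_mul_of_nonneg_left hx.2 hd0.le
    simp only [hvε]
    linarith
  have hTw := hT a b hcoef hdrift hSob _ Kw _ hKw hw0 hwM hw Z hZm hZs hZc hZw
  have hkw := hk a b hcoef hdrift hSob' _ Kw _ hKw hw0 hwM hw hTw x hx
  have h1 : Real.exp (-k) ≤ vε x := by
    rw [← Real.le_log_iff_exp_le (hvεpos x)]
    linarith
  have h2 : vε x ≤ v x + ε := by
    have hd1 : d ≤ 1 := inv_le_one_of_one_le₀ (by linarith)
    have := mul_le_mul_of_nonneg_right hd1 (add_nonneg (hv0 x) hε.le)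
    simp only [hvε]
    linarith
  exact h1.trans h2

end LowerBound

/-! ### Rescaling to the unit ball -/

section Scaling

variable {n : ℕ} {a : Rn n → Matrix (Fin n) (Fin n) ℝ} {b : Rn n → Rn n} {R : ℝ}

/-- The matrix `a(Rx)`. -/
def scaleMatrix (a : Rn n → Matrix (Fin n) (Fin n) ℝ) (R : ℝ) :
    Rn n → Matrix (Fin n) (Fin n) ℝ := fun x => a (R • x)

/-- The drift `R b(Rx)`. -/
def scaleDrift (b : Rn n → Rn n) (R : ℝ) : Rn n → Rn n := fun x => R • b (R • x)

theorem quasiMeasurePreserving_smul_volume (hR : R ≠ 0) :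
    Measure.QuasiMeasurePreserving (fun x : Rn n => R • x) volume volume := by
  refine ⟨measurable_const_smul R, ?_⟩
  rw [Measure.map_addHaar_smul _ hR]
  exact Measure.smul_absolutelyContinuous

theorem gradient_comp_smul (f : Rn n → ℝ) (c : ℝ) (x : Rn n) :
    gradient (fun y => f (c • y)) x = c • gradient f (c • x) := by
  unfold gradient
  rw [fderiv_comp_smul, map_smul]

theorem gradient_affine (f : Rn n → ℝ) (c d : ℝ) (x : Rn n) :
    gradient (fun y => c * f y + d) x = c • gradient f x := by
  unfold gradient
  have h : fderiv ℝ (fun y => c * f y + d) x = c • fderiv ℝ f x := by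
    rw [fderiv_add_const]
    exact congrFun (fderiv_const_smul_field (𝕜 := ℝ) (f := f) c) x
  rw [h, map_smul]

theorem weakForm_affine (a : Rn n → Matrix (Fin n) (Fin n) ℝ) (b : Rn n → Rn n)
    (u η : Rn n → ℝ) (c d : ℝ) :
    weakForm a b (fun x => c * u x + d) η = c * weakForm a b u η := by
  rw [weakForm_eq, weakForm_eq, ← integral_const_mul]
  congr 1
  ext x
  rw [gradient_affine, aform_smul_left, inner_smul_right]
  ring

/-- The factor R in the drift and R^(-n/q) from the change of variables combine to the power in the
scaled norm. -/
theorem eLpNorm_scaleDrift (b : Rn n → Rn n) {q : ℝ} (hq : 0 < q) (hR : 0 < R) :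
    eLpNorm (scaleDrift b R) (ENNReal.ofReal q) (ballMeasure n) = scaledNorm b q R := by
  have hemb : MeasurableEmbedding (fun x : Rn n => R • x) :=
    (Homeomorph.smulOfNeZero R hR.ne').measurableEmbedding
  have hpre : (fun x : Rn n => R • x) ⁻¹' Metric.ball 0 R = Metric.ball 0 1 := by
    ext x
    simp only [Set.mem_preimage, mem_ball_zero_iff, norm_smul, Real.norm_of_nonneg hR.le]
    exact mul_lt_iff_lt_one_right hR
  have h1 : eLpNorm (fun x => b (R • x)) (ENNReal.ofReal q) (ballMeasure n) =
      ENNReal.ofReal (R ^ (-((n : ℝ) / q))) *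
        eLpNorm b (ENNReal.ofReal q) (volume.restrict (Metric.ball 0 R)) := by
    have h2 := hemb.eLpNorm_map_measure (g := b) (p := ENNReal.ofReal q) (μ := ballMeasure n)
    have h3 : Measure.map (fun x : Rn n => R • x) (ballMeasure n) =
        ENNReal.ofReal ((R ^ n)⁻¹) • volume.restrict (Metric.ball (0 : Rn n) R) := by
      rw [ballMeasure, ← hpre, ← hemb.restrict_map, Measure.map_addHaar_smul _ hR.ne',
        finrank_euclideanSpace_fin, Measure.restrict_smul, abs_of_pos (by positivity)]
    rw [h3, eLpNorm_smul_measure_of_ne_top ENNReal.ofReal_ne_top, smul_eq_mul] at h2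
    rw [show (fun x => b (R • x)) = b ∘ fun x => R • x from rfl, ← h2]
    congr 1
    rw [one_div, ENNReal.toReal_inv, ENNReal.toReal_ofReal hq.le,
      ENNReal.ofReal_rpow_of_pos (by positivity), Real.inv_rpow (by positivity),
      ← Real.rpow_natCast, ← Real.rpow_mul hR.le, ← Real.rpow_neg hR.le, div_eq_mul_inv]
  rw [show scaleDrift b R = R • fun x => b (R • x) from rfl, eLpNorm_const_smul, h1, scaledNorm,
    ← mul_assoc, Real.enorm_eq_ofReal hR.le, ← ENNReal.ofReal_mul hR.le]
  congr 2
  rw [sub_eq_add_neg, Real.rpow_add hR, Real.rpow_one]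

theorem exists_norm_aform_bound (ha : ∀ i j, MemLp (fun x => a x i j) ⊤ volume) :
    ∃ Λ : ℝ, 0 ≤ Λ ∧ ∀ᵐ x ∂(volume : Measure (Rn n)), ∀ p r : Rn n,
      |aform (a x) p r| ≤ Λ * ‖p‖ * ‖r‖ := by
  set c : Fin n → Fin n → ℝ := fun i j => (eLpNorm (fun x => a x i j) ⊤ volume).toReal
  have hc (i j : Fin n) : 0 ≤ c i j := ENNReal.toReal_nonneg
  set C : ℝ := ∑ i, ∑ j, c i j
  have hC : 0 ≤ C := Finset.sum_nonneg fun i _ => Finset.sum_nonneg fun j _ => hc i j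
  refine ⟨n ^ 2 * C, by positivity, ?_⟩
  have h : ∀ i j, ∀ᵐ x ∂(volume : Measure (Rn n)), |a x i j| ≤ C := fun i j => by
    filter_upwards [ae_le_eLpNormEssSup (f := fun x => a x i j) (μ := volume)] with x hx
    have h1 : |a x i j| ≤ c i j := by
      have := ENNReal.toReal_mono (ha i j).eLpNorm_ne_top
        (hx.trans_eq eLpNorm_exponent_top.symm)
      rwa [toReal_enorm, Real.norm_eq_abs] at this
    have h2 : c i j ≤ ∑ j, c i j :=
      Finset.single_le_sum (fun j _ => hc i j) (Finset.mem_univ j)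
    have h3 : ∑ j, c i j ≤ C :=
      Finset.single_le_sum (f := fun i => ∑ j, c i j)
        (fun i _ => Finset.sum_nonneg fun j _ => hc i j) (Finset.mem_univ i)
    linarith
  have h' : ∀ᵐ x ∂(volume : Measure (Rn n)), ∀ i j, |a x i j| ≤ C :=
    ae_all_iff.2 fun i => ae_all_iff.2 fun j => h i j
  filter_upwards [h'] with x hx p r
  exact abs_aform_le hx p r

theorem MemLqLoc.locallyIntegrable {q : ℝ} (hq : 1 ≤ q) (hb : MemLqLoc b q) :
    LocallyIntegrable b (volume : Measure (Rn n)) := by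
  rw [locallyIntegrable_iff]
  intro k hk
  have : IsFiniteMeasure (volume.restrict k) :=
    ⟨by rw [Measure.restrict_apply_univ]; exact hk.measure_lt_top⟩
  exact (hb k hk).integrable (by rwa [ENNReal.one_le_ofReal])

theorem isTest_comp_inv_smul {φ : Rn n → ℝ} (hφ : IsTest φ) (hR : 0 < R) :
    IsTest fun x => φ (R⁻¹ • x) := by
  obtain ⟨⟨K, hK⟩, hs, h0⟩ := hφ
  refine ⟨⟨K * ‖R⁻¹‖₊, hK.comp (lipschitzWith_smul R⁻¹)⟩, ?_, fun x => h0 _⟩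
  exact hs.comp_homeomorph (Homeomorph.smulOfNeZero R⁻¹ (inv_ne_zero hR.ne'))

theorem integral_comp_smul_nonneg {F : Rn n → ℝ} (hF : 0 ≤ ∫ x, F x) (R : ℝ) :
    0 ≤ ∫ x, F (R • x) := by
  rw [Measure.integral_comp_smul, smul_eq_mul]
  exact mul_nonneg (abs_nonneg _) hF

theorem ballCoeff_scale {ν Λ q : ℝ} (hν : 0 < ν) (hΛ : 0 ≤ Λ) (hq : 1 ≤ q) (hR : 0 < R)
    (ha : ∀ i j, MemLp (fun x => a x i j) ⊤ volume)
    (haΛ : ∀ᵐ x ∂(volume : Measure (Rn n)), ∀ p r : Rn n, |aform (a x) p r| ≤ Λ * ‖p‖ * ‖r‖)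
    (hell : IsUniformlyElliptic a ν) (hb : MemLqLoc b q) (hdiv : DivNonpos b)
    (hbR : MemLp (scaleDrift b R) (ENNReal.ofReal q) (ballMeasure n)) :
    BallCoeff (scaleMatrix a R) (scaleDrift b R) ν Λ where
  nu_pos := hν
  lam_nonneg := hΛ
  elliptic := by
    have h : ∀ᵐ x ∂(volume : Measure (Rn n)), ∀ p : Rn n, ν * ‖p‖ ^ 2 ≤ aform (a x) p p := by
      filter_upwards [hell] with x hx p
      refine (hx p).1.trans_eq ?_
      exact Finset.sum_congr rfl fun i _ => Finset.sum_congr rfl fun j _ => by ring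
    exact (quasiMeasurePreserving_smul_volume hR.ne').ae h
  bounded := (quasiMeasurePreserving_smul_volume hR.ne').ae haΛ
  aestronglyMeasurable i j :=
    (ha i j).1.comp_quasiMeasurePreserving (quasiMeasurePreserving_smul_volume hR.ne')
  integrable := hbR.integrable (by rwa [ENNReal.one_le_ofReal])
  div_nonpos φ hφ hφ0 := by
    have h := integral_inner_gradient_nonneg (hb.locallyIntegrable hq) hdiv
      (isTest_comp_inv_smul hφ hR)
    have h1 := mul_nonneg (sq_nonneg R) (integral_comp_smul_nonneg h R)
    rw [integral_ballMeasure fun x hx => by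
      rw [gradient_eq_zero_of_nonneg hφ.2.2 (hφ0 x hx), inner_zero_right]]
    refine h1.trans_eq ?_
    rw [← integral_const_mul]
    congr 1
    ext x
    rw [gradient_comp_smul, smul_smul, inv_mul_cancel₀ hR.ne', one_smul, scaleDrift,
      inner_smul_left, inner_smul_right]
    simp only [conj_trivial]
    field_simp

theorem ballSupersolution_scale {u v : Rn n → ℝ} (hR : 0 < R)
    (hu : ∀ η, IsTest η → 0 ≤ weakForm a b u η) (huv : ∀ x, ‖x‖ < 1 → v x = u (R • x)) :
    BallSupersolution (scaleMatrix a R) (scaleDrift b R) v := by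
  intro η hη hη0
  have h := hu _ (isTest_comp_inv_smul hη hR)
  rw [weakForm_eq] at h
  have h1 := mul_nonneg (sq_nonneg R) (integral_comp_smul_nonneg h R)
  refine h1.trans_eq ?_
  rw [← integral_const_mul, ← integral_ballMeasure]
  · refine setIntegral_congr_fun Metric.isOpen_ball.measurableSet fun x hx => ?_
    have hv : gradient v x = R • gradient u (R • x) := by
      rw [← gradient_comp_smul]
      refine gradient_congr ?_
      filter_upwards [Metric.isOpen_ball.mem_nhds hx] with y hy
      exact huv y (mem_ball_zero_iff.1 hy)
    rw [hv, gradient_comp_smul, smul_smul, inv_mul_cancel₀ hR.ne', one_smul, scaleDrift,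
      scaleMatrix, inner_smul_left, inner_smul_right, aform_smul_left, aform_smul_right,
      conj_trivial]
    field_simp
  · intro x hx
    rw [gradient_comp_smul, smul_smul, inv_mul_cancel₀ hR.ne', one_smul, hη0 x hx,
      gradient_eq_zero_of_nonneg hη.2.2 (hη0 x hx), smul_zero, mul_zero]
    simp [aform]

/-- The growth lemma asks for globally Lipschitz functions with values in [0, 1]. A locally
Lipschitz function is Lipschitz on the closed unit ball; extend it from there and clamp. The
equation on the open ball does not see the change. -/
theorem exists_lipschitz_extension {v : Rn n → ℝ} (hv : LocallyLipschitz v) (h0 : ∀ x, 0 ≤ v x)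
    (h1 : ∀ x, v x ≤ 1) : ∃ (g : Rn n → ℝ) (K : NNReal), LipschitzWith K g ∧ (∀ x, 0 ≤ g x) ∧
      (∀ x, g x ≤ 1) ∧ ∀ x, ‖x‖ < 1 → g x = v x := by
  obtain ⟨K, hK⟩ := hv.locallyLipschitzOn.exists_lipschitzOnWith_of_compact
    (isCompact_closedBall (0 : Rn n) 1)
  obtain ⟨g, hg, hgv⟩ := hK.extend_real
  refine ⟨fun x => max (min (g x) 1) 0, K, (hg.min_const 1).max_const 0, fun x => le_max_right _ _,
    fun x => max_le (min_le_right _ _) zero_le_one, fun x hx => ?_⟩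
  simp only
  rw [← hgv (by rw [mem_closedBall_zero_iff]; exact hx.le), min_eq_left (h1 x), max_eq_left (h0 x)]

end Scaling

end EllipticLiouville

/-! ### The Liouville theorem -/

open EllipticLiouville in
theorem corollary2p4 (n : ℕ) (hn : 2 ≤ n) (ν q : ℝ) (hν : 0 < ν)
    (hq : (n : ℝ) / 2 < q) (hqn : q ≤ (n : ℝ))
    (a : EllipticLiouville.Rn n → Matrix (Fin n) (Fin n) ℝ)
    (b : EllipticLiouville.Rn n → EllipticLiouville.Rn n)
    (ha : ∀ i j, MemLp (fun x => a x i j) ⊤ volume)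
    (hell : EllipticLiouville.IsUniformlyElliptic a ν)
    (hb : EllipticLiouville.MemLqLoc b q)
    (hdiv : EllipticLiouville.DivNonpos b)
    (hlim : liminf (fun R : ℝ => EllipticLiouville.scaledNorm b q R) atTop < ⊤)
    (u : EllipticLiouville.Rn n → ℝ)
    (hu : EllipticLiouville.IsSolution a b u)
    (hbdd : ∃ M : ℝ, ∀ x, |u x| ≤ M) :
    ∃ c : ℝ, ∀ x, u x = c := by
  obtain ⟨M₀, hM₀⟩ := hbdd
  have hn0 : (2 : ℝ) ≤ n := by exact_mod_cast hn
  have hq1 : 1 < q := by linarith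
  have hbelow : BddBelow (Set.range u) := ⟨-M₀, by rintro _ ⟨x, rfl⟩; exact (abs_le.1 (hM₀ x)).1⟩
  have habove : BddAbove (Set.range u) := ⟨M₀, by rintro _ ⟨x, rfl⟩; exact (abs_le.1 (hM₀ x)).2⟩
  set m := ⨅ x, u x with hm
  set M := ⨆ x, u x with hM
  have hmu (x : Rn n) : m ≤ u x := ciInf_le hbelow x
  have huM (x : Rn n) : u x ≤ M := le_ciSup habove x
  rcases le_or_gt M m with hmM | hmM
  · exact ⟨m, fun x => le_antisymm ((huM x).trans hmM) (hmu x)⟩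
  exfalso
  have hd : 0 < M - m := by linarith
  obtain ⟨Λ, hΛ, haΛ⟩ := exists_norm_aform_bound ha
  obtain ⟨N, hN, -⟩ := ENNReal.lt_iff_exists_nnreal_btwn.1 hlim
  -- The scaled norm is bounded by `N` only for some arbitrarily large radii, and a single such
  -- radius suffices.
  have hfreq := frequently_lt_of_liminf_lt (by isBoundedDefault) hN
  obtain ⟨δ, hδ, hgrow⟩ := exists_lower_bound hn (Λ := Λ) hν hq N.coe_nonneg
  -- The extrema need not be attained. Points violating the growth bound for either normalisation
  -- are chosen before `R`, which is then taken so large that both lie in B_{R/2}.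
  obtain ⟨x₁, hx₁⟩ : ∃ x, u x < m + δ * (M - m) :=
    exists_lt_of_ciInf_lt (by have := mul_pos hδ hd; linarith)
  obtain ⟨x₂, hx₂⟩ : ∃ x, M - δ * (M - m) < u x :=
    exists_lt_of_lt_ciSup (by have := mul_pos hδ hd; linarith)
  obtain ⟨R, hRN, hR⟩ := (hfreq.and_eventually
    (eventually_gt_atTop (2 * (‖x₁‖ + ‖x₂‖)))).exists
  have hR0 : 0 < R := by have := norm_nonneg x₁; have := norm_nonneg x₂; linarith
  have hnorm := eLpNorm_scaleDrift b (zero_lt_one.trans hq1) hR0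
  have hbR : MemLp (scaleDrift b R) (ENNReal.ofReal q) (ballMeasure n) := by
    refine ⟨?_, ?_⟩
    · exact (((hb.locallyIntegrable hq1.le).aestronglyMeasurable.comp_quasiMeasurePreserving
        (quasiMeasurePreserving_smul_volume hR0.ne')).const_smul R).restrict
    · rw [hnorm]; exact hRN.trans ENNReal.coe_lt_top
  have hcoef := ballCoeff_scale hν hΛ hq1.le hR0 ha haΛ hell hb hdiv hbR
  have hbN : eLpNorm (scaleDrift b R) (ENNReal.ofReal q) (ballMeasure n) ≤ ENNReal.ofReal N := by
    rw [hnorm, ENNReal.ofReal_coe_nnreal]; exact hRN.le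
  have hzero (η : Rn n → ℝ) (hη : IsTest η) : weakForm a b u η = 0 :=
    le_antisymm (hu.1.2 η hη) (hu.2.2 η hη)
  have hlip : LocallyLipschitz fun x : Rn n => u (R • x) :=
    hu.1.1.comp (lipschitzWith_smul R).locallyLipschitz
  have hsmall (y : Rn n) (hy : 2 * ‖y‖ < R) : ‖R⁻¹ • y‖ < 1 / 2 := by
    rw [norm_smul, norm_inv, Real.norm_of_nonneg hR0.le, inv_mul_lt_iff₀ hR0]
    linarith
  -- The sign of `c` is free because the weak form of `u` vanishes; this is the place where `u` must
  -- be a solution and not only a supersolution.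
  have hmain (c d : ℝ) (hv0 : ∀ x, 0 ≤ c * u x + d) (hv1 : ∀ x, c * u x + d ≤ 1)
      (hvol : volume (Metric.ball (0 : Rn n) (1 / 2)) ≤
        2 * volume (Metric.ball (0 : Rn n) (1 / 2) ∩ {x | 1 / 2 ≤ c * u (R • x) + d}))
      (y : Rn n) (hy : 2 * ‖y‖ < R) : δ ≤ c * u y + d := by
    have hl : LocallyLipschitz fun x : Rn n => c * u (R • x) + d := by
      have : LipschitzWith ‖c‖₊ fun t : ℝ => c * t + d :=
        LipschitzWith.of_dist_le_mul fun s t => by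
          rw [dist_add_right, Real.dist_eq, ← mul_sub, abs_mul]; rfl
      exact this.locallyLipschitz.comp hlip
    obtain ⟨g, K, hK, hg0, hg1, hg⟩ := exists_lipschitz_extension hl (fun x => hv0 _) fun x => hv1 _
    have hsup : BallSupersolution (scaleMatrix a R) (scaleDrift b R) g :=
      ballSupersolution_scale (u := fun x => c * u x + d) hR0
        (fun η hη => by rw [weakForm_affine, hzero η hη, mul_zero]) hg
    have hset : Metric.ball (0 : Rn n) (1 / 2) ∩ {x | 1 / 2 ≤ c * u (R • x) + d} =
        Metric.ball (0 : Rn n) (1 / 2) ∩ {x | 1 / 2 ≤ g x} := by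
      ext x
      simp only [Set.mem_inter_iff, mem_ball_zero_iff, Set.mem_ofPred_eq]
      refine and_congr_right fun hx => ?_
      rw [hg x (by linarith)]
    rw [hset] at hvol
    have h := hgrow _ _ hcoef hbR hbN g K hK hg0 hg1 hsup hvol _ (hsmall y hy)
    rwa [hg _ (by linarith [hsmall y hy]), smul_smul, mul_inv_cancel₀ hR0.ne', one_smul] at h
  set c : ℝ := (M - m)⁻¹ with hc
  have hc0 : 0 < c := inv_pos.2 hd
  have hcd : c * (M - m) = 1 := inv_mul_cancel₀ hd.ne'
  have hlo (x : Rn n) : 0 ≤ c * (u x - m) := mul_nonneg hc0.le (by linarith [hmu x])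
  have hhi (x : Rn n) : 0 ≤ c * (M - u x) := mul_nonneg hc0.le (by linarith [huM x])
  set A := Metric.ball (0 : Rn n) (1 / 2) ∩ {x | 1 / 2 ≤ c * u (R • x) + -(c * m)} with hA
  set B := Metric.ball (0 : Rn n) (1 / 2) ∩ {x | 1 / 2 ≤ -c * u (R • x) + c * M} with hB
  -- The two normalisations add up to 1, so at each point one of them is at least 1/2, and one of
  -- the two sets fills half of the ball.
  have hcover : volume (Metric.ball (0 : Rn n) (1 / 2)) ≤ volume A + volume B := by
    refine (measure_mono fun x hx => ?_).trans (measure_union_le A B)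
    by_cases h : 1 / 2 ≤ c * u (R • x) + -(c * m)
    · exact Or.inl ⟨hx, h⟩
    · refine Or.inr ⟨hx, ?_⟩
      simp only [Set.mem_ofPred_eq]
      linarith
  rcases le_total (volume B) (volume A) with h | h
  · have h1 := hmain c (-(c * m)) (fun x => by linarith [hlo x]) (fun x => by linarith [hhi x])
      (by rw [two_mul]; exact hcover.trans (by gcongr)) x₁
      (by have := norm_nonneg x₂; linarith)
    have h2 := mul_lt_mul_of_pos_left hx₁ hc0
    have h3 : c * (m + δ * (M - m)) = c * m + δ * (c * (M - m)) := by ring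
    rw [h3, hcd] at h2
    linarith
  · have h1 := hmain (-c) (c * M) (fun x => by linarith [hhi x]) (fun x => by linarith [hlo x])
      (by rw [two_mul]; exact hcover.trans (by gcongr)) x₂
      (by have := norm_nonneg x₁; linarith)
    have h2 := mul_lt_mul_of_pos_left hx₂ hc0
    have h3 : c * (M - δ * (M - m)) = c * M - δ * (c * (M - m)) := by ring
    rw [h3, hcd] at h2
    linarith

end
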